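/- **Conventions.** Let $N\ge 1$ be an integer, $\alpha>-1$, $\mathbb B_N$ the open unit ball and $\mathbb S_N$ the unit sphere of $\mathbb C^N$. An *Orlicz function* is a strictly convex function $\psi:[0,\infty)\to[0,\infty)$ with $\psi(0)=0$, continuous at $0$, and $\psi(x)/x\to+\infty$ as $x\to\infty$; it is a bijection of $[0,\infty)$, with inverse $\psi^{-1}$. It satisfies the *$\nabla_0$-Condition* if there are $x_0>0$ and $C\ge 1$ such that $$\frac{\psi(2x)}{\psi(x)}\le\frac{\psi(2Cy)}{\psi(y)}\qquad\text{whenever } x_0\le x\le y .$$ For a finite positive Borel measure $\mu$ on $\mathbb B_N$, $L^\psi(\mu)$ is the space of (classes of) measurable $f:\mathbb B_N\to\mathbb C$ with $\int\psi(|f|/C)\,d\mu<\infty$ for some $C>0$, with the Luxemburg norm $\|f\|_{L^\psi(\mu)}=\inf\{C>0:\int\psi(|f|/C)\,d\mu\le 1\}$. Let $dv_\alpha(z)=c_\alpha(1-|z|^2)^\alpha\,dv(z)$, where $v$ is Lebesgue measure on $\mathbb B_N$ normalized to have mass $1$ and $c_\alpha=\frac{\Gamma(N+\alpha+1)}{N!\,\Gamma(\alpha+1)}$.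 The weighted Bergman–Orlicz space $A^\psi_\alpha(\mathbb B_N)$ is the space of holomorphic functions on $\mathbb B_N$ that belong to $L^\psi(v_\alpha)$, with the norm of $L^\psi(v_\alpha)$. It *embeds compactly into* $L^\psi(\mu)$ if every $f\in A^\psi_\alpha(\mathbb B_N)$ belongs to $L^\psi(\mu)$ and every bounded sequence in $A^\psi_\alpha(\mathbb B_N)$ has a subsequence that converges in the norm of $L^\psi(\mu)$ to an element of $L^\psi(\mu)$. For $\xi\in\mathbb S_N$ and $0<h\le1$, the *Carleson window* is $$W(\xi,h)=\Big\{z\in\mathbb B_N:\ 1-|z|<h,\ \Big|1-\Big\langle\xi,\tfrac{z}{|z|}\Big\rangle\Big|<h\Big\}.$$ **Corollary 2.11.** Let $N\ge1$, $\alpha>-1$, let $\psi$ be an Orlicz function satisfying the $\nabla_0$-Condition, and let $\mu$ be a finite positive Borel measure on $\mathbb B_N$. Then $A^\psi_\alpha(\mathbb B_N)$ embeds compactly into $L^\psi(\mu)$ if and only if $\mu$ is a *vanishing $(\psi,\alpha)$-Bergman–Carleson measure*, i.e. for every $A>0$, $$\mu\big(W(\xi,h)\big)=o\!\left(\frac{1}{\psi\big(A\,\psi^{-1}(1/h^{N+1+\alpha})\big)}\right)\qquad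 (h\to0^+),$$ uniformly with respect to $\xi\in\mathbb S_N$. -/

import Mathlib

open MeasureTheory Filter Topology
open scoped ENNReal NNReal

noncomputable section

namespace BergmanOrlicz

/-! ### Orlicz functions -/

/-- `ψ` is an Orlicz function. Only the values of `ψ` on `[0, ∞)` matter. -/
structure IsOrliczFunction (ψ : ℝ → ℝ) : Prop where
  nonneg : ∀ x, 0 ≤ x → 0 ≤ ψ x
  strictConvexOn : StrictConvexOn ℝ (Set.Ici 0) ψ
  map_zero : ψ 0 = 0
  continuous_zero : ContinuousWithinAt ψ (Set.Ici 0) 0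
  tendsto_div_atTop : Tendsto (fun x => ψ x / x) atTop atTop

/-- The condition `∇₀`. -/
def NablaZero (ψ : ℝ → ℝ) : Prop :=
  ∃ x₀ : ℝ, 0 < x₀ ∧ ∃ C : ℝ, 1 ≤ C ∧
    ∀ x y : ℝ, x₀ ≤ x → x ≤ y → ψ (2 * x) / ψ x ≤ ψ (2 * C * y) / ψ y

/-- The inverse `ψ⁻¹ : [0, ∞) → [0, ∞)` of an Orlicz function (which is a bijection of `[0, ∞)`). -/
def orliczInv (ψ : ℝ → ℝ) : ℝ → ℝ :=
  Function.invFunOn ψ (Set.Ici 0)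

/-! ### Orlicz spaces -/

section Orlicz

variable {Ω : Type*} [MeasurableSpace Ω]

/-- The modular `∫ ψ (|f| / C) dμ`, with values in `[0, ∞]`. -/
def modular (ψ : ℝ → ℝ) (f : Ω → ℂ) (μ : Measure Ω) (C : ℝ) : ℝ≥0∞ :=
  ∫⁻ z, ENNReal.ofReal (ψ (‖f z‖ / C)) ∂μ

/-- `f` (up to equality almost everywhere) belongs to the Orlicz space `L^ψ(μ)`. -/
def MemOrlicz (ψ : ℝ → ℝ) (f : Ω → ℂ) (μ : Measure Ω) : Prop :=
  AEStronglyMeasurable f μ ∧ ∃ C : ℝ, 0 < C ∧ modular ψ f μ C < ∞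

/-- The Luxemburg norm `inf {C > 0 : ∫ ψ (|f| / C) dμ ≤ 1}`, with values in `[0, ∞]`
(it is `∞` when there is no such `C`). -/
def luxemburgNorm (ψ : ℝ → ℝ) (f : Ω → ℂ) (μ : Measure Ω) : ℝ≥0∞ :=
  ⨅ (C : ℝ) (_ : 0 < C) (_ : modular ψ f μ C ≤ 1), ENNReal.ofReal C

end Orlicz

/-! ### The unit ball and weighted Bergman-Orlicz spaces -/

/-- The open unit ball of `ℂ^N`. -/
def unitBall (N : ℕ) : Set (EuclideanSpace ℂ (Fin N)) :=
  Metric.ball 0 1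

/-- The unit sphere of `ℂ^N`. -/
def unitSphere (N : ℕ) : Set (EuclideanSpace ℂ (Fin N)) :=
  Metric.sphere 0 1

/-- The normalized Lebesgue measure of the unit ball, as a measure on `ℂ^N` carried by the ball. -/
def ballVolume (N : ℕ) : Measure (EuclideanSpace ℂ (Fin N)) :=
  (volume (unitBall N))⁻¹ • volume.restrict (unitBall N)

/-- The normalizing constant `c_α = Γ(N + α + 1) / (N! Γ(α + 1))`. -/
def weightConst (N : ℕ) (α : ℝ) : ℝ :=
  Real.Gamma (N + α + 1) / (N.factorial * Real.Gamma (α + 1))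

/-- The weighted measure `dv_α(z) = c_α (1 - |z|²)^α dv(z)`, carried by the unit ball. -/
def weightedVolume (N : ℕ) (α : ℝ) : Measure (EuclideanSpace ℂ (Fin N)) :=
  (ballVolume N).withDensity
    fun z => ENNReal.ofReal (weightConst N α * (1 - ‖z‖ ^ 2) ^ α)

/-- The weighted Bergman-Orlicz space `A^ψ_α(𝔹_N) = H(𝔹_N) ∩ L^ψ(v_α)`. A function on the ball is
represented by a function on `ℂ^N`, whose values off the ball play no role. -/
def bergmanOrlicz (N : ℕ) (α : ℝ) (ψ : ℝ → ℝ) : Set (EuclideanSpace ℂ (Fin N) → ℂ) :=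
  {f | DifferentiableOn ℂ f (unitBall N) ∧ MemOrlicz ψ f (weightedVolume N α)}

/-- `A^ψ_α(𝔹_N)` embeds compactly into `L^ψ(μ)`, for a measure `μ` carried by the ball:
the space is contained in `L^ψ(μ)`, and every sequence that is bounded in `A^ψ_α(𝔹_N)` has a
subsequence that converges in the norm of `L^ψ(μ)` to an element of `L^ψ(μ)`. -/
def EmbedsCompactly (N : ℕ) (α : ℝ) (ψ : ℝ → ℝ)
    (μ : Measure (EuclideanSpace ℂ (Fin N))) : Prop :=
  (∀ f ∈ bergmanOrlicz N α ψ, MemOrlicz ψ f μ) ∧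
  ∀ f : ℕ → EuclideanSpace ℂ (Fin N) → ℂ,
    (∀ n, f n ∈ bergmanOrlicz N α ψ) →
    (∃ R : ℝ≥0, ∀ n, luxemburgNorm ψ (f n) (weightedVolume N α) ≤ R) →
    ∃ g : EuclideanSpace ℂ (Fin N) → ℂ, MemOrlicz ψ g μ ∧
      ∃ φ : ℕ → ℕ, StrictMono φ ∧
        Tendsto (fun n => luxemburgNorm ψ (f (φ n) - g) μ) atTop (𝓝 0)

/-! ### Carleson windows and vanishing Bergman-Carleson measures -/

/-- The non-isotropic distance `d(ζ, ξ) = √|1 - ⟨ζ, ξ⟩|` (the order of the arguments of the inner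
product does not affect the modulus). -/
def nonisotropicDist {N : ℕ} (ζ ξ : EuclideanSpace ℂ (Fin N)) : ℝ :=
  √‖1 - inner ℂ ζ ξ‖

/-- The Carleson window `W(ζ, h)`, for `ζ` in the unit sphere and `0 < h ≤ 1`
(for such `h` the origin does not belong to it). -/
def carlesonWindow {N : ℕ} (ζ : EuclideanSpace ℂ (Fin N)) (h : ℝ) :
    Set (EuclideanSpace ℂ (Fin N)) :=
  {z | z ∈ unitBall N ∧ 1 - ‖z‖ < h ∧ nonisotropicDist ζ ((‖z‖⁻¹ : ℂ) • z) ^ 2 < h}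

/-- `μ` is a vanishing `(ψ, α)`-Bergman-Carleson measure: for every `A > 0`,
`μ(W(ξ, h)) = o(1 / ψ(A ψ⁻¹(1 / h^(N + 1 + α))))` as `h → 0⁺`, uniformly in `ξ` in the sphere. -/
def IsVanishingBergmanCarleson (N : ℕ) (α : ℝ) (ψ : ℝ → ℝ)
    (μ : Measure (EuclideanSpace ℂ (Fin N))) : Prop :=
  ∀ A : ℝ, 0 < A → ∀ ε : ℝ, 0 < ε → ∀ᶠ h : ℝ in 𝓝[>] 0, ∀ ξ ∈ unitSphere N,
    μ (carlesonWindow ξ h) ≤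
      ENNReal.ofReal (ε * (1 / ψ (A * orliczInv ψ (1 / h ^ ((N : ℝ) + 1 + α)))))

end BergmanOrlicz

end

open MeasureTheory Filter Topology
open scoped ENNReal NNReal

noncomputable section

/-! Write `d = N + 1 + α`; a Carleson window of size `h` has `v_α`-measure of order at most `h ^ d`.

Sufficiency rests on a uniform tail estimate, `exists_setLIntegral_le`: for every `K`, the
`μ`-integral of `ψ(K|g|)` near the sphere is small, uniformly over the unit ball of the
Bergman–Orlicz space. Averaging over circles and Jensen's inequality give a sub-mean value property
of `ψ(|g|)` on a nonisotropic neighbourhood `D(z)`, hence `|g(z)| ≤ y` with `ψ(y) = C / (1 - |z|²) ^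
d`. Iterating `∇₀` gives `ψ(K|g(z)|) ψ(y) ≤ ψ(|g(z)|) ψ(By)` when `|g(z)|` is not small. The factor
`ψ(y)` cancels the one in the sub-mean value property and leaves `ψ(K|g(z)|) ≤ ψ(By) ∫_{D(z)} ψ(|g|)
dv_α`. After integration in `μ` and Tonelli, the points `z` with `w ∈ D(z)` lie in a window of size
`20(1 - |w|²)`, and the vanishing condition with a suitable `A` makes the inner integral at most `ε
/ 2` times `ψ(|g(w)|)`. Compactness then follows from normal families: a pointwise convergent
subsequence, dominated convergence on `|z| ≤ r`, and the tail estimate outside.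

Necessity tests the embedding on `ψ⁻¹(1/h ^ d) (h / (1 + h - ⟨z, ξ⟩)) ^ k` with `k ≥ d + 1`. These
functions are bounded in norm, tend to `0` pointwise as `h → 0`, and on the window `W(ξ, h)` are at
least `3 ^ (-k)` times their amplitude. Compactness makes a subsequence tend to `0` in `L^ψ(μ)`, and
Chebyshev's inequality bounds the mass of the window. -/

namespace BergmanOrlicz

/-! ### Orlicz functions: consequences of convexity, the inverse, iteration of `∇₀`. -/

namespace IsOrliczFunction

variable {ψ : ℝ → ℝ}

/-- Convexity between `x` and `0`, where `ψ` vanishes. This is what moves scalar factors through `ψ`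
in the absence of any doubling condition. -/
theorem map_mul_le (hψ : IsOrliczFunction ψ) {t x : ℝ} (ht : 0 ≤ t) (ht1 : t ≤ 1) (hx : 0 ≤ x) :
    ψ (t * x) ≤ t * ψ x := by
  have := hψ.strictConvexOn.convexOn.2 (x := x) (y := 0) hx (by simp) ht (sub_nonneg.2 ht1)
    (by ring)
  simpa [hψ.map_zero] using this

theorem mul_map_le (hψ : IsOrliczFunction ψ) {t x : ℝ} (ht : 1 ≤ t) (hx : 0 ≤ x) :
    t * ψ x ≤ ψ (t * x) := by
  have h0 : 0 < t := by linarith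
  have := hψ.map_mul_le (t := t⁻¹) (x := t * x) (by positivity) (inv_le_one_of_one_le₀ ht)
    (by positivity)
  rw [inv_mul_cancel_left₀ h0.ne'] at this
  calc t * ψ x ≤ t * (t⁻¹ * ψ (t * x)) := by gcongr
    _ = ψ (t * x) := by field_simp

theorem pos (hψ : IsOrliczFunction ψ) {x : ℝ} (hx : 0 < x) : 0 < ψ x := by
  have := hψ.strictConvexOn.2 hx.le (Set.self_mem_Ici (a := (0 : ℝ))) hx.ne'
    one_half_pos one_half_pos (add_halves 1)
  simp only [smul_eq_mul, mul_zero, add_zero, hψ.map_zero] at this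
  have h2 := hψ.nonneg (1 / 2 * x) (by positivity)
  linarith

theorem strictMonoOn (hψ : IsOrliczFunction ψ) : StrictMonoOn ψ (Set.Ici 0) := by
  intro x hx y hy hxy
  have hx' : 0 ≤ x := hx
  have hy0 : 0 < y := hx'.trans_lt hxy
  have h := hψ.map_mul_le (t := x / y) (x := y) (by positivity) ((div_le_one hy0).2 hxy.le) hy0.le
  rw [div_mul_cancel₀ _ hy0.ne'] at h
  refine h.trans_lt ?_
  have := hψ.pos hy0
  have h1 : x / y < 1 := (div_lt_one hy0).2 hxy
  nlinarith

theorem mono (hψ : IsOrliczFunction ψ) {x y : ℝ} (hx : 0 ≤ x) (hxy : x ≤ y) : ψ x ≤ ψ y :=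
  hψ.strictMonoOn.monotoneOn hx (hx.trans hxy) hxy

theorem continuousOn (hψ : IsOrliczFunction ψ) : ContinuousOn ψ (Set.Ici 0) := by
  intro x hx
  rcases eq_or_lt_of_le (show 0 ≤ x from hx) with rfl | hx0
  · exact hψ.continuous_zero
  · have h := hψ.strictConvexOn.convexOn.continuousOn_interior
    rw [interior_Ici] at h
    exact (h.continuousAt (Ioi_mem_nhds hx0)).continuousWithinAt

theorem continuous_comp (hψ : IsOrliczFunction ψ) {X : Type*} [TopologicalSpace X] {f : X → ℝ}
    (hf : Continuous f) (h0 : ∀ x, 0 ≤ f x) : Continuous fun x => ψ (f x) :=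
  hψ.continuousOn.comp_continuous hf h0

theorem tendsto_atTop (hψ : IsOrliczFunction ψ) : Tendsto ψ atTop atTop := by
  refine tendsto_atTop_mono' _ ?_ (tendsto_id (α := ℝ))
  filter_upwards [hψ.tendsto_div_atTop.eventually_ge_atTop 1, eventually_gt_atTop 0] with x h1 h2
  rw [le_div_iff₀ h2] at h1
  simpa using h1

theorem surjOn (hψ : IsOrliczFunction ψ) : Set.SurjOn ψ (Set.Ici 0) (Set.Ici 0) := by
  intro t ht
  have ht' : 0 ≤ t := ht
  obtain ⟨b, hb, hb0⟩ := ((hψ.tendsto_atTop.eventually_ge_atTop t).and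
    (eventually_ge_atTop 0)).exists
  have := intermediate_value_Icc hb0 (hψ.continuousOn.mono Set.Icc_subset_Ici_self)
  obtain ⟨x, hx, rfl⟩ := this ⟨by rw [hψ.map_zero]; exact ht', hb⟩
  exact ⟨x, hx.1, rfl⟩

theorem orliczInv_nonneg (hψ : IsOrliczFunction ψ) {t : ℝ} (ht : 0 ≤ t) : 0 ≤ orliczInv ψ t :=
  Function.invFunOn_mem (hψ.surjOn ht)

theorem map_orliczInv (hψ : IsOrliczFunction ψ) {t : ℝ} (ht : 0 ≤ t) :
    ψ (orliczInv ψ t) = t :=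
  Function.invFunOn_eq (hψ.surjOn ht)

theorem le_orliczInv (hψ : IsOrliczFunction ψ) {x t : ℝ} (hx : 0 ≤ x) (h : ψ x ≤ t) :
    x ≤ orliczInv ψ t := by
  have ht : 0 ≤ t := (hψ.nonneg x hx).trans h
  rw [← hψ.map_orliczInv ht] at h
  exact (hψ.strictMonoOn.le_iff_le hx (hψ.orliczInv_nonneg ht)).1 h

theorem orliczInv_pos (hψ : IsOrliczFunction ψ) {t : ℝ} (ht : 0 < t) : 0 < orliczInv ψ t := by
  refine lt_of_le_of_ne (hψ.orliczInv_nonneg ht.le) fun h => ?_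
  have := hψ.map_orliczInv ht.le
  rw [← h, hψ.map_zero] at this
  exact ht.ne this

theorem orliczInv_mono (hψ : IsOrliczFunction ψ) {s t : ℝ} (hs : 0 ≤ s) (h : s ≤ t) :
    orliczInv ψ s ≤ orliczInv ψ t :=
  hψ.le_orliczInv (hψ.orliczInv_nonneg hs) (by rwa [hψ.map_orliczInv hs])

/-- A constant in front of `1/h ^ d` thus becomes a constant in front of `ψ⁻¹(1/h ^ d)`, where the
freedom of `A` in the vanishing condition absorbs it. -/
theorem orliczInv_mul_le (hψ : IsOrliczFunction ψ) {M t : ℝ} (hM : 1 ≤ M) (ht : 0 ≤ t) :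
    orliczInv ψ (M * t) ≤ M * orliczInv ψ t := by
  have hi := hψ.orliczInv_nonneg ht
  have hMt : 0 ≤ M * t := by positivity
  refine (hψ.strictMonoOn.le_iff_le (hψ.orliczInv_nonneg hMt)
    (show 0 ≤ M * orliczInv ψ t by positivity)).1 ?_
  rw [hψ.map_orliczInv hMt]
  have := hψ.mul_map_le hM hi
  rwa [hψ.map_orliczInv ht] at this

/-- Iterating the condition `∇₀` replaces the factor `2` by an arbitrary factor. -/
theorem exists_mul_le_of_nablaZero (hψ : IsOrliczFunction ψ) (h0 : NablaZero ψ) :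
    ∃ x₀ : ℝ, 0 < x₀ ∧ ∀ K : ℝ, 0 ≤ K → ∃ B : ℝ, 0 < B ∧
      ∀ x y : ℝ, x₀ ≤ x → x ≤ y → ψ (K * x) * ψ y ≤ ψ x * ψ (B * y) := by
  obtain ⟨x₀, hx₀, C, hC, h⟩ := h0
  refine ⟨x₀, hx₀, fun K hK => ?_⟩
  obtain ⟨m, hm⟩ := pow_unbounded_of_one_lt K (one_lt_two (α := ℝ))
  refine ⟨(2 * C) ^ m, by positivity, fun x y hx hxy => ?_⟩
  have hx0 : 0 < x := hx₀.trans_le hx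
  have hy0 : 0 < y := hx0.trans_le hxy
  have key : ∀ j : ℕ, ψ (2 ^ j * x) * ψ y ≤ ψ x * ψ ((2 * C) ^ j * y) := by
    intro j
    induction j with
    | zero => simp
    | succ j ih =>
      have hp : (1 : ℝ) ≤ 2 ^ j := one_le_pow₀ (by norm_num)
      have hp' : (2 : ℝ) ^ j ≤ (2 * C) ^ j := by gcongr; linarith
      -- The two arguments stay ordered along the iteration because `C ≥ 1`.
      have h2 := h (2 ^ j * x) ((2 * C) ^ j * y) (by nlinarith) (by gcongr)
      have q1 : 0 < ψ (2 ^ j * x) := hψ.pos (by positivity)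
      have q2 : 0 < ψ ((2 * C) ^ j * y) := hψ.pos (by positivity)
      have q3 : 0 < ψ y := hψ.pos hy0
      rw [div_le_div_iff₀ q1 q2, ← mul_assoc, ← mul_assoc, ← pow_succ', ← pow_succ'] at h2
      have q4 : 0 < ψ ((2 * C) ^ (j + 1) * y) := hψ.pos (by positivity)
      -- Product of the `∇₀` inequality with the induction hypothesis; the common positive factor
      -- then cancels.
      have hq : ψ (2 ^ (j + 1) * x) * ψ y * (ψ (2 ^ j * x) * ψ ((2 * C) ^ j * y)) ≤
          ψ x * ψ ((2 * C) ^ (j + 1) * y) * (ψ (2 ^ j * x) * ψ ((2 * C) ^ j * y)) := by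
        calc _ = (ψ (2 ^ (j + 1) * x) * ψ ((2 * C) ^ j * y)) * (ψ (2 ^ j * x) * ψ y) := by ring
          _ ≤ (ψ ((2 * C) ^ (j + 1) * y) * ψ (2 ^ j * x)) * (ψ x * ψ ((2 * C) ^ j * y)) := by
            gcongr
          _ = _ := by ring
      exact le_of_mul_le_mul_right hq (by positivity)
  refine le_trans ?_ (key m)
  have := hψ.nonneg y hy0.le
  gcongr
  exact hψ.mono (by positivity) (by gcongr)

end IsOrliczFunction

/-! ### Modulars and the Luxemburg norm. -/

section Luxemburg

variable {Ω : Type*} [MeasurableSpace Ω] {ψ : ℝ → ℝ} {μ : Measure Ω} {f : Ω → ℂ}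

theorem modular_anti (hψ : IsOrliczFunction ψ) {C C' : ℝ} (hC : 0 < C) (h : C ≤ C') :
    modular ψ f μ C' ≤ modular ψ f μ C :=
  lintegral_mono fun z => ENNReal.ofReal_le_ofReal
    (hψ.mono (by have := hC.trans_le h; positivity) (by gcongr))

theorem modular_le_one_of_luxemburgNorm_lt (hψ : IsOrliczFunction ψ) {R : ℝ}
    (h : luxemburgNorm ψ f μ < ENNReal.ofReal R) : modular ψ f μ R ≤ 1 := by
  simp only [luxemburgNorm, iInf_lt_iff] at h
  obtain ⟨C, hC, hm, hR⟩ := h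
  exact (modular_anti hψ hC (ENNReal.lt_ofReal_iff_toReal_lt (by simp) |>.1 hR |>.le.trans'
    (by rw [ENNReal.toReal_ofReal hC.le]))).trans hm

theorem luxemburgNorm_le {C : ℝ} (hC : 0 < C) (h : modular ψ f μ C ≤ 1) :
    luxemburgNorm ψ f μ ≤ ENNReal.ofReal C :=
  iInf_le_of_le C (iInf_le_of_le hC (iInf_le _ h))

/-- Reduces norm convergence to bounds on modulars at every scale, so the rest of the argument
handles integrals only. -/
theorem tendsto_luxemburgNorm_zero_iff (hψ : IsOrliczFunction ψ) {F : ℕ → Ω → ℂ} :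
    Tendsto (fun n => luxemburgNorm ψ (F n) μ) atTop (𝓝 0) ↔
      ∀ δ : ℝ, 0 < δ → ∀ᶠ n in atTop, modular ψ (F n) μ δ ≤ 1 := by
  constructor
  · intro h δ hδ
    filter_upwards [h.eventually_lt_const (ENNReal.ofReal_pos.2 hδ)] with n hn
    exact modular_le_one_of_luxemburgNorm_lt hψ hn
  · intro h
    rw [ENNReal.tendsto_nhds_zero]
    intro ε hε
    rcases eq_or_ne ε ∞ with rfl | hε'
    · simp
    have hpos := ENNReal.toReal_pos hε.ne' hε'
    filter_upwards [h ε.toReal hpos] with n hn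
    simpa [ENNReal.ofReal_toReal hε'] using luxemburgNorm_le hpos hn

theorem modular_mul_le (hψ : IsOrliczFunction ψ) {C t : ℝ} (hC : 0 < C) (ht : 1 ≤ t) :
    modular ψ f μ (t * C) ≤ ENNReal.ofReal t⁻¹ * modular ψ f μ C := by
  have ht0 : 0 < t := by linarith
  rw [modular, modular, ← lintegral_const_mul' _ _ (by simp)]
  refine lintegral_mono fun z => ?_
  rw [← ENNReal.ofReal_mul (by positivity)]
  refine ENNReal.ofReal_le_ofReal ?_
  have := hψ.map_mul_le (t := t⁻¹) (x := ‖f z‖ / C) (by positivity) (inv_le_one_of_one_le₀ ht)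
    (by positivity)
  convert this using 2
  field_simp

theorem exists_modular_le_one (hψ : IsOrliczFunction ψ) (h : MemOrlicz ψ f μ) :
    ∃ C : ℝ, 0 < C ∧ modular ψ f μ C ≤ 1 := by
  obtain ⟨-, C, hC, hfin⟩ := h
  set m := (modular ψ f μ C).toReal with hm
  have h0 : 0 ≤ m := ENNReal.toReal_nonneg
  -- The factor `m + 1` is at least `1`, as `modular_mul_le` demands, and brings the modular down to
  -- `m / (m + 1)`.
  refine ⟨(m + 1) * C, by positivity, (modular_mul_le hψ hC (by linarith)).trans ?_⟩
  rw [← ENNReal.ofReal_toReal hfin.ne, ← ENNReal.ofReal_mul (by positivity), ← hm]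
  rw [ENNReal.ofReal_le_one, inv_mul_le_iff₀ (by positivity)]
  linarith

/-- Fatou's lemma for modulars. -/
theorem modular_le_liminf (hψ : IsOrliczFunction ψ) {F : ℕ → Ω → ℂ} {C : ℝ} (hC : 0 < C)
    (hF : ∀ n, AEStronglyMeasurable (F n) μ)
    (hlim : ∀ᵐ z ∂μ, Tendsto (fun n => F n z) atTop (𝓝 (f z))) :
    modular ψ f μ C ≤ liminf (fun n => modular ψ (F n) μ C) atTop := by
  have hc : Continuous fun w : ℂ => ENNReal.ofReal (ψ (‖w‖ / C)) :=
    ENNReal.continuous_ofReal.comp (hψ.continuous_comp (by fun_prop) fun w => by positivity)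
  calc modular ψ f μ C
      = ∫⁻ z, liminf (fun n => ENNReal.ofReal (ψ (‖F n z‖ / C))) atTop ∂μ := by
        refine lintegral_congr_ae ?_
        filter_upwards [hlim] with z hz
        exact ((hc.tendsto _).comp hz).liminf_eq.symm
    _ ≤ _ := lintegral_liminf_le' fun n =>
        (hc.measurable.comp_aemeasurable (hF n).aemeasurable)

end Luxemburg

/-! ### Polar coordinates and volumes of nonisotropic sets. -/

/-- Polar coordinates on a cone `K`. -/
theorem setLIntegral_cone_le {E : Type*} [NormedAddCommGroup E] [NormedSpace ℝ E]
    [MeasurableSpace E] [BorelSpace E] [FiniteDimensional ℝ E] [Nontrivial E] (μ : Measure E)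
    [μ.IsAddHaarMeasure] {K : Set E} (hK : MeasurableSet K)
    (hcone : ∀ r : ℝ, 0 < r → ∀ z, r • z ∈ K ↔ z ∈ K) {F : ℝ → ℝ≥0∞} (hF : Measurable F) :
    ∫⁻ z in K, F ‖z‖ ∂μ ≤ Module.finrank ℝ E * μ (K ∩ Metric.ball 0 1) *
      ∫⁻ r in Set.Ioi (0 : ℝ), ENNReal.ofReal (r ^ (Module.finrank ℝ E - 1)) * F r := by
  set d := Module.finrank ℝ E
  set K' : Set (Metric.sphere (0 : E) 1) := Subtype.val ⁻¹' K with hK'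
  have hK'm : MeasurableSet K' := measurable_subtype_coe hK
  -- The surface measure is by definition `d` times the volume of the cone over `K'` in the ball,
  -- and that cone lies in `K` by homogeneity.
  have hsphere : μ.toSphere K' ≤ d * μ (K ∩ Metric.ball 0 1) := by
    rw [Measure.toSphere_apply' _ hK'm]
    gcongr
    rintro _ ⟨r, hr, _, ⟨x, hx, rfl⟩, rfl⟩
    refine ⟨(hcone r hr.1 _).2 hx, ?_⟩
    simpa [norm_smul, abs_of_pos hr.1] using hr.2
  have hvol : ∫⁻ r : Set.Ioi (0 : ℝ), F r ∂(Measure.volumeIoiPow (d - 1)) =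
      ∫⁻ r in Set.Ioi (0 : ℝ), ENNReal.ofReal (r ^ (d - 1)) * F r := by
    rw [Measure.volumeIoiPow, lintegral_withDensity_eq_lintegral_mul _ (by fun_prop) (by fun_prop)]
    exact lintegral_subtype_comap measurableSet_Ioi
      fun r : ℝ => ENNReal.ofReal (r ^ (d - 1)) * F r
  calc ∫⁻ z in K, F ‖z‖ ∂μ
      = ∫⁻ z : ({(0)}ᶜ : Set E), K.indicator (fun z => F ‖z‖) z.1 ∂(μ.comap (↑)) := by
        rw [lintegral_subtype_comap (measurableSet_singleton _).compl
          (K.indicator fun z : E => F ‖z‖), restrict_compl_singleton, lintegral_indicator hK]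
    _ = ∫⁻ p : Metric.sphere (0 : E) 1 × Set.Ioi (0 : ℝ), K'.indicator 1 p.1 * F p.2
          ∂μ.toSphere.prod (.volumeIoiPow (d - 1)) := by
        rw [← μ.measurePreserving_homeomorphUnitSphereProd.lintegral_comp_emb
          (Homeomorph.measurableEmbedding _)]
        refine lintegral_congr fun z => ?_
        have hz : 0 < ‖z.1‖ := norm_pos_iff.2 z.2
        have hmem : ((homeomorphUnitSphereProd E z).1 ∈ K') ↔ z.1 ∈ K := by
          simp only [hK', Set.mem_preimage, homeomorphUnitSphereProd_apply_fst_coe]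
          exact hcone _ (by positivity) _
        by_cases h : z.1 ∈ K
        · simp [h, hmem.2 h]
        · simp [h, mt hmem.1 h]
    _ = μ.toSphere K' * ∫⁻ r : Set.Ioi (0 : ℝ), F r ∂(Measure.volumeIoiPow (d - 1)) := by
        rw [← lintegral_indicator_one hK'm]
        exact lintegral_prod_mul (f := K'.indicator 1) (g := fun r : Set.Ioi (0 : ℝ) => F r)
          (measurable_one.indicator hK'm).aemeasurable
          (hF.comp measurable_subtype_coe).aemeasurable
    _ ≤ _ := by
        rw [hvol]
        gcongr

variable {N : ℕ}

/-- Uniqueness of Haar measure; the value of the constant never matters, only that it is nonzero. -/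
theorem exists_volume_preimage_ofLp (N : ℕ) : ∃ c : ℝ≥0, c ≠ 0 ∧ ∀ S : Set (Fin N → ℂ),
    MeasurableSet S →
      volume ((WithLp.ofLp : EuclideanSpace ℂ (Fin N) → Fin N → ℂ) ⁻¹' S) = c * volume S := by
  let L : EuclideanSpace ℂ (Fin N) ≃L[ℝ] (Fin N → ℂ) := PiLp.continuousLinearEquiv 2 ℝ _
  set ν : Measure (Fin N → ℂ) := volume.map L with hν
  have h := Measure.isAddLeftInvariant_eq_smul ν (volume : Measure (Fin N → ℂ))
  refine ⟨Measure.addHaarScalarFactor ν volume, ?_, fun S hS => ?_⟩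
  · intro h0
    rw [h0, zero_smul] at h
    exact NeZero.ne ν h
  · have h2 : ν S = Measure.addHaarScalarFactor ν volume * volume S := by
      conv_lhs => rw [h]
      rfl
    rw [← h2, hν, Measure.map_apply L.continuous.measurable hS]
    rfl

/-- The volume of a box in unitary coordinates with prescribed first basis vector. -/
theorem exists_volume_box (N : ℕ) [NeZero N] : ∃ c : ℝ≥0, c ≠ 0 ∧
    ∀ ξ ∈ unitSphere N, ∃ e : EuclideanSpace ℂ (Fin N) ≃ₗᵢ[ℂ] EuclideanSpace ℂ (Fin N),
      (∀ u, e u 0 = inner ℂ ξ u) ∧ ∀ S₀ S₁ : Set ℂ, MeasurableSet S₀ → MeasurableSet S₁ →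
        volume {u | e u 0 ∈ S₀ ∧ ∀ i, i ≠ 0 → e u i ∈ S₁} =
          c * (volume S₀ * volume S₁ ^ (N - 1)) := by
  obtain ⟨c, hc, h⟩ := exists_volume_preimage_ofLp N
  refine ⟨c, hc, fun ξ hξ => ?_⟩
  have hξ1 : ‖ξ‖ = 1 := by simpa [unitSphere] using hξ
  obtain ⟨b, hb⟩ := Orthonormal.exists_orthonormalBasis_extension_of_card_eq (𝕜 := ℂ)
    (E := EuclideanSpace ℂ (Fin N)) (ι := Fin N) (by simp) (v := fun _ => ξ) (s := {0})
    ⟨fun i => hξ1, fun i j hij => absurd (Subsingleton.elim i j) hij⟩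
  refine ⟨b.repr, fun u => ?_, fun S₀ S₁ h₀ h₁ => ?_⟩
  · rw [b.repr_apply_apply, hb 0 rfl]
  · let e' : EuclideanSpace ℂ (Fin N) ≃ₗᵢ[ℝ] EuclideanSpace ℂ (Fin N) :=
      { b.repr.toLinearEquiv.restrictScalars ℝ with norm_map' := b.repr.norm_map }
    have hS : MeasurableSet (Set.univ.pi fun i : Fin N => if i = 0 then S₀ else S₁) :=
      MeasurableSet.univ_pi fun i => by split_ifs <;> assumption
    have h2 := e'.measurePreserving.measure_preimage
      ((WithLp.measurable_ofLp 2 (Fin N → ℂ)) hS).nullMeasurableSet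
    rw [h _ hS] at h2
    have hset : {u | b.repr u 0 ∈ S₀ ∧ ∀ i, i ≠ 0 → b.repr u i ∈ S₁} = e' ⁻¹' (WithLp.ofLp ⁻¹'
        (Set.univ.pi fun i : Fin N => if i = 0 then S₀ else S₁)) := by
      ext u
      simp only [Set.mem_ofPred_eq, Set.mem_preimage, Set.mem_univ_pi]
      constructor
      · rintro ⟨h1, h2⟩ i
        split_ifs with hi
        · subst hi; exact h1
        · exact h2 i hi
      · intro hu
        refine ⟨?_, fun i hi => ?_⟩
        · have := hu 0
          rwa [if_pos rfl] at this
        · have := hu i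
          rwa [if_neg hi] at this
    rw [hset, h2, volume_pi_pi, ← Finset.mul_prod_erase _ _ (Finset.mem_univ (0 : Fin N)),
      Finset.prod_congr rfl (g := fun _ => volume S₁)
        (fun i hi => by rw [if_neg (Finset.ne_of_mem_erase hi)])]
    simp

/-- Lower bound for the volume of nonisotropic balls. -/
theorem exists_le_volume_nonisotropic_ball (N : ℕ) [NeZero N] {a : ℝ} (ha : 0 < a) :
    ∃ c : ℝ, 0 < c ∧ ∀ ξ ∈ unitSphere N, ∀ h : ℝ, 0 < h → h ≤ 1 →
      ENNReal.ofReal (c * h ^ (N + 1)) ≤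
        volume {u : EuclideanSpace ℂ (Fin N) | ‖inner ℂ ξ u‖ < a * h ∧ ‖u‖ ^ 2 < a ^ 2 * h} := by
  obtain ⟨c, hc, H⟩ := exists_volume_box N
  have hN : (0 : ℝ) < N := Nat.cast_pos.2 (Nat.pos_of_ne_zero (NeZero.ne N))
  have hN1 : (1 : ℝ) ≤ N := Nat.one_le_cast.2 (Nat.pos_of_ne_zero (NeZero.ne N))
  -- With this radius, `N` coordinates of squared modulus below `s² h` add up to less than `a² h`.
  set s : ℝ := a / √N with hs
  have hs0 : 0 < s := by positivity
  have hsq : s ^ 2 * N = a ^ 2 := by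
    rw [hs, div_pow, Real.sq_sqrt hN.le]; field_simp
  have hsa : s ≤ a := by
    rw [hs]; exact div_le_self ha.le (Real.one_le_sqrt.2 hN1)
  refine ⟨c * (Real.pi * s ^ 2) ^ N, by positivity, fun ξ hξ h hh hh1 => ?_⟩
  obtain ⟨e, he, hv⟩ := H ξ hξ
  have hv := hv (Metric.ball 0 (s * h)) (Metric.ball 0 (s * √h)) measurableSet_ball
    measurableSet_ball
  rw [Complex.volume_ball, Complex.volume_ball] at hv
  have hpi : ((NNReal.pi : ℝ≥0) : ℝ≥0∞) = ENNReal.ofReal Real.pi := by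
    rw [← NNReal.coe_real_pi, ENNReal.ofReal_coe_nnreal]
  have hcc : ((c : ℝ≥0) : ℝ≥0∞) = ENNReal.ofReal c := by simp
  rw [hpi, hcc, ← ENNReal.ofReal_pow (by positivity), ← ENNReal.ofReal_pow (by positivity),
    ← ENNReal.ofReal_mul (by positivity), ← ENNReal.ofReal_mul (by positivity),
    ← ENNReal.ofReal_pow (by positivity), ← ENNReal.ofReal_mul (by positivity),
    ← ENNReal.ofReal_mul (by positivity)] at hv
  -- One disc of radius `s h` and `N - 1` discs of radius `s √h` produce the exponent `2 + (N - 1) =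
  -- N + 1`.
  calc ENNReal.ofReal (c * (Real.pi * s ^ 2) ^ N * h ^ (N + 1)) = _ := by
        congr 1
        rw [mul_pow s (√h), Real.sq_sqrt hh.le]
        obtain ⟨m, rfl⟩ : ∃ m, N = m + 1 := Nat.exists_eq_succ_of_ne_zero (NeZero.ne N)
        simp only [Nat.add_sub_cancel]
        ring
    _ = _ := hv.symm
    _ ≤ _ := by
        refine measure_mono fun u hu => ?_
        obtain ⟨h0, h1⟩ := hu
        rw [mem_ball_zero_iff] at h0
        constructor
        · rw [← he]
          exact h0.trans_le (by gcongr)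
        · rw [← e.norm_map u, EuclideanSpace.norm_sq_eq]
          have hi : ∀ i ∈ Finset.univ, ‖e u i‖ ^ 2 < s ^ 2 * h := by
            intro i _
            rcases eq_or_ne i 0 with rfl | hi
            · calc ‖e u 0‖ ^ 2 < (s * h) ^ 2 := by gcongr
                _ = s ^ 2 * (h * h) := by ring
                _ ≤ s ^ 2 * h := by gcongr; nlinarith
            · have := h1 i hi
              rw [mem_ball_zero_iff] at this
              calc ‖e u i‖ ^ 2 < (s * √h) ^ 2 := by gcongr
                _ = s ^ 2 * h := by rw [mul_pow, Real.sq_sqrt hh.le]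
          calc _ < ∑ _i : Fin N, s ^ 2 * h := Finset.sum_lt_sum_of_nonempty Finset.univ_nonempty hi
            _ = a ^ 2 * h := by
              rw [← hsq]; simp; ring

/-- Upper bound for the volume of the cone over a nonisotropic ball of the sphere. -/
theorem exists_volume_cone_le (N : ℕ) [NeZero N] :
    ∃ C : ℝ, 0 < C ∧ ∀ ξ ∈ unitSphere N, ∀ s : ℝ, 0 < s →
      volume ({z : EuclideanSpace ℂ (Fin N) | ‖inner ℂ ξ z - (‖z‖ : ℂ)‖ ≤ s * ‖z‖} ∩
        Metric.ball 0 1) ≤ ENNReal.ofReal (C * s ^ N) := by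
  obtain ⟨c, hc, H⟩ := exists_volume_box N
  refine ⟨c * 4 * (2 * Real.pi) ^ (N - 1), by positivity, fun ξ hξ s hs => ?_⟩
  obtain ⟨e, he, hv⟩ := H ξ hξ
  -- The cone is enclosed in a box: subtracting the real number `|z|` does not change the imaginary
  -- part of `⟨ξ, z⟩`, which is therefore at most `s`, and the remaining coordinates have squared
  -- modulus at most `|z|² - |⟨ξ, z⟩|² ≤ 2s`.
  have hm : MeasurableSet (Set.Icc (-1 : ℝ) 1 ×ℂ Set.Icc (-s) s) :=
    (isClosed_Icc.reProdIm isClosed_Icc).measurableSet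
  have hvol : volume (Set.Icc (-1 : ℝ) 1 ×ℂ Set.Icc (-s) s) = ENNReal.ofReal (4 * s) := by
    have := Complex.volume_preserving_equiv_real_prod.measure_preimage
      (measurableSet_Icc.prod measurableSet_Icc :
        MeasurableSet (Set.Icc (-1 : ℝ) 1 ×ˢ Set.Icc (-s) s)).nullMeasurableSet
    rw [Measure.volume_eq_prod, Measure.prod_prod, Real.volume_Icc, Real.volume_Icc,
      ← ENNReal.ofReal_mul (by norm_num)] at this
    convert this using 2
    · rfl
    · ring
  have hv := hv _ (Metric.closedBall 0 (√(2 * s))) hm measurableSet_closedBall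
  rw [hvol, Complex.volume_closedBall] at hv
  have hpi : ((NNReal.pi : ℝ≥0) : ℝ≥0∞) = ENNReal.ofReal Real.pi := by
    rw [← NNReal.coe_real_pi, ENNReal.ofReal_coe_nnreal]
  have hcc : ((c : ℝ≥0) : ℝ≥0∞) = ENNReal.ofReal c := by simp
  rw [hpi, hcc, ← ENNReal.ofReal_pow (by positivity), Real.sq_sqrt (by positivity),
    ← ENNReal.ofReal_mul (by positivity),
    ← ENNReal.ofReal_pow (by positivity), ← ENNReal.ofReal_mul (by positivity),
    ← ENNReal.ofReal_mul (by positivity)] at hv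
  calc _ ≤ volume {u | e u 0 ∈ Set.Icc (-1 : ℝ) 1 ×ℂ Set.Icc (-s) s ∧
            ∀ i, i ≠ 0 → e u i ∈ Metric.closedBall 0 (√(2 * s))} := by
        refine measure_mono ?_
        rintro z ⟨hz, hz1⟩
        rw [Set.mem_ofPred_eq, ← he] at hz
        rw [mem_ball_zero_iff] at hz1
        have hz0 := norm_nonneg z
        have h0 : ‖e z 0‖ ≤ ‖z‖ := by
          rw [← e.norm_map z]; exact PiLp.norm_apply_le _ _
        have hsz : s * ‖z‖ ≤ s := by nlinarith
        refine ⟨⟨?_, ?_⟩, fun i hi => ?_⟩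
        · exact abs_le.1 ((Complex.abs_re_le_norm _).trans (h0.trans hz1.le))
        · have := (Complex.abs_im_le_norm _).trans hz
          simp only [Complex.sub_im, Complex.ofReal_im, sub_zero] at this
          exact abs_le.1 (this.trans hsz)
        · rw [mem_closedBall_zero_iff]
          refine Real.le_sqrt_of_sq_le ?_
          have hsum : ‖z‖ ^ 2 = ∑ j, ‖e z j‖ ^ 2 := by
            rw [← e.norm_map z, EuclideanSpace.norm_sq_eq]
          have hpair : ‖e z 0‖ ^ 2 + ‖e z i‖ ^ 2 ≤ ∑ j, ‖e z j‖ ^ 2 := by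
            rw [← Finset.sum_pair hi.symm (f := fun j => ‖e z j‖ ^ 2)]
            exact Finset.sum_le_sum_of_subset_of_nonneg (Finset.subset_univ _)
              fun _ _ _ => by positivity
          have h3 : ‖z‖ - ‖e z 0‖ ≤ s := by
            have := norm_sub_norm_le (‖z‖ : ℂ) (e z 0)
            rw [norm_sub_rev, Complex.norm_real, norm_norm] at this
            linarith
          have := norm_nonneg (e z 0)
          nlinarith
    _ = _ := hv
    _ = _ := by
        congr 1
        obtain ⟨m, rfl⟩ : ∃ m, N = m + 1 := Nat.exists_eq_succ_of_ne_zero (NeZero.ne N)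
        simp only [Nat.add_sub_cancel]
        ring

/-! ### The weighted volume: nonisotropic balls and kernel integrals. -/

variable {α : ℝ}

theorem weightConst_pos (hα : -1 < α) : 0 < weightConst N α := by
  have h1 : 0 < Real.Gamma (N + α + 1) :=
    Real.Gamma_pos_of_pos (by have : (0 : ℝ) ≤ N := Nat.cast_nonneg N; linarith)
  have h2 : 0 < Real.Gamma (α + 1) := Real.Gamma_pos_of_pos (by linarith)
  rw [weightConst]
  positivity

theorem measurableSet_unitBall : MeasurableSet (unitBall N) := measurableSet_ball

theorem volume_unitBall_ne_zero : volume (unitBall N) ≠ 0 :=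
  (Metric.measure_ball_pos _ _ one_pos).ne'

theorem volume_unitBall_ne_top : volume (unitBall N) ≠ ∞ := measure_ball_lt_top.ne

theorem measurable_weight : Measurable fun z : EuclideanSpace ℂ (Fin N) =>
    ENNReal.ofReal (weightConst N α * (1 - ‖z‖ ^ 2) ^ α) := by
  fun_prop

theorem lintegral_weightedVolume {f : EuclideanSpace ℂ (Fin N) → ℝ≥0∞} (hf : Measurable f) :
    ∫⁻ z, f z ∂weightedVolume N α = (volume (unitBall N))⁻¹ *
      ∫⁻ z in unitBall N, ENNReal.ofReal (weightConst N α * (1 - ‖z‖ ^ 2) ^ α) * f z := by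
  rw [weightedVolume, lintegral_withDensity_eq_lintegral_mul _ measurable_weight hf, ballVolume,
    lintegral_smul_measure]
  rfl

theorem weightedVolume_compl_unitBall : weightedVolume N α (unitBall N)ᶜ = 0 := by
  refine withDensity_absolutelyContinuous _ _ ?_
  simp [ballVolume, Measure.restrict_apply measurableSet_unitBall.compl]

theorem ae_mem_unitBall : ∀ᵐ z ∂weightedVolume N α, z ∈ unitBall N :=
  mem_ae_iff.2 weightedVolume_compl_unitBall

instance : SFinite (weightedVolume N α) := by
  unfold weightedVolume ballVolume
  infer_instance

theorem norm_inner_le_norm {ξ z : EuclideanSpace ℂ (Fin N)} (hξ : ξ ∈ unitSphere N) :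
    ‖(inner ℂ ξ z : ℂ)‖ ≤ ‖z‖ := by
  have := _root_.norm_inner_le_norm (𝕜 := ℂ) ξ z
  rwa [mem_sphere_zero_iff_norm.1 hξ, one_mul] at this

/-- Factor `1 - r² = (1 + r)(1 - r)` with `1 ≤ 1 + r ≤ 2`; the absolute value covers negative `α`.
-/
theorem one_sub_sq_rpow_le {r : ℝ} (h0 : 0 ≤ r) (h1 : r < 1) :
    (1 - r ^ 2) ^ α ≤ 2 ^ |α| * (1 - r) ^ α := by
  have : (1 - r ^ 2) = (1 + r) * (1 - r) := by ring
  rw [this, Real.mul_rpow (by linarith) (by linarith)]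
  have h2 : 0 ≤ (1 - r) ^ α := Real.rpow_nonneg (by linarith) _
  gcongr
  calc (1 + r) ^ α ≤ (1 + r) ^ |α| := Real.rpow_le_rpow_of_exponent_le (by linarith) (le_abs_self α)
    _ ≤ 2 ^ |α| := by gcongr; linarith

theorem lintegral_one_sub_rpow (hα : -1 < α) {t : ℝ} (ht : 0 < t) :
    ∫⁻ r in Set.Ioo (1 - t) 1, ENNReal.ofReal ((1 - r) ^ α) =
      ENNReal.ofReal (t ^ (α + 1) / (α + 1)) := by
  calc _ = ∫⁻ r, (Set.Ioo 0 t).indicator (fun x => ENNReal.ofReal (x ^ α)) (1 - r) := by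
        rw [← lintegral_indicator measurableSet_Ioo]
        refine lintegral_congr fun r => ?_
        have : r ∈ Set.Ioo (1 - t) 1 ↔ 1 - r ∈ Set.Ioo 0 t := by
          simp only [Set.mem_Ioo]
          constructor <;> rintro ⟨h1, h2⟩ <;> constructor <;> linarith
        by_cases hr : r ∈ Set.Ioo (1 - t) 1
        · rw [Set.indicator_of_mem hr, Set.indicator_of_mem (this.1 hr)]
        · rw [Set.indicator_of_notMem hr, Set.indicator_of_notMem (mt this.2 hr)]
    _ = ∫⁻ x in Set.Ioc 0 t, ENNReal.ofReal (x ^ α) := by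
        rw [lintegral_sub_left_eq_self (fun x => (Set.Ioo 0 t).indicator
          (fun x => ENNReal.ofReal (x ^ α)) x), lintegral_indicator measurableSet_Ioo,
          restrict_Ioo_eq_restrict_Ioc]
    _ = _ := by
        rw [← ofReal_integral_eq_lintegral_ofReal
          (intervalIntegral.intervalIntegrable_rpow' hα (a := 0) (b := t)).1,
          ← intervalIntegral.integral_of_le ht.le, integral_rpow (Or.inl hα),
          Real.zero_rpow (by linarith), sub_zero]
        filter_upwards [ae_restrict_mem measurableSet_Ioc] with x hx
        exact Real.rpow_nonneg hx.1.le _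

/-- Upper bound for the weighted volume of nonisotropic balls centred at a boundary point. -/
theorem exists_weightedVolume_le (N : ℕ) [NeZero N] (hα : -1 < α) :
    ∃ C : ℝ, 0 < C ∧ ∀ ξ ∈ unitSphere N, ∀ t : ℝ, 0 < t →
      weightedVolume N α {z | ‖1 - (inner ℂ ξ z : ℂ)‖ < t} ≤
        ENNReal.ofReal (C * t ^ ((N : ℝ) + 1 + α)) := by
  obtain ⟨C, hC, hcone⟩ := exists_volume_cone_le N
  set d := Module.finrank ℝ (EuclideanSpace ℂ (Fin N)) with hd
  set A : ℝ := weightConst N α * 2 ^ |α| with hA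
  have hA0 : 0 < A := mul_pos (weightConst_pos hα) (by positivity)
  set V : ℝ := (volume (unitBall N)).toReal with hV
  have hV0 : 0 < V := ENNReal.toReal_pos volume_unitBall_ne_zero volume_unitBall_ne_top
  have hα1 : 0 < α + 1 := by linarith
  -- The summand `1` only makes positivity of the constant immediate.
  refine ⟨V⁻¹ * (d * (C * 4 ^ N) * (A / (α + 1))) + 1, by positivity, fun ξ hξ t ht => ?_⟩
  have : Nontrivial (EuclideanSpace ℂ (Fin N)) :=
    ⟨ξ, 0, fun h => by simp [h, unitSphere] at hξ⟩
  set S : Set (EuclideanSpace ℂ (Fin N)) := {z | ‖1 - (inner ℂ ξ z : ℂ)‖ < t} with hS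
  have hSm : MeasurableSet S := (isOpen_lt (by fun_prop) (by fun_prop)).measurableSet
  set K : Set (EuclideanSpace ℂ (Fin N)) :=
    {z | ‖inner ℂ ξ z - (‖z‖ : ℂ)‖ ≤ (4 * t) * ‖z‖} with hK
  have hKm : MeasurableSet K := (isClosed_le (by fun_prop) (by fun_prop)).measurableSet
  have hKc : ∀ r : ℝ, 0 < r → ∀ z, r • z ∈ K ↔ z ∈ K := by
    intro r hr z
    have h1 : (inner ℂ ξ (r • z) : ℂ) - (‖r • z‖ : ℂ) = r * (inner ℂ ξ z - (‖z‖ : ℂ)) := by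
      rw [inner_smul_right_eq_smul, norm_smul, Real.norm_of_nonneg hr.le]
      simp only [Complex.real_smul, Complex.ofReal_mul]
      ring
    simp only [hK, Set.mem_ofPred_eq]
    rw [h1, norm_mul, Complex.norm_real, norm_smul, Real.norm_of_nonneg hr.le,
      mul_left_comm, mul_le_mul_iff_right₀ hr]
  set F : ℝ → ℝ≥0∞ := (Set.Ioo (1 - t) 1).indicator fun r => ENNReal.ofReal (A * (1 - r) ^ α)
    with hF
  have hFm : Measurable F := Measurable.indicator (by fun_prop) measurableSet_Ioo
  have hpt : ∀ z ∈ unitBall N, ENNReal.ofReal (weightConst N α * (1 - ‖z‖ ^ 2) ^ α) *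
      S.indicator 1 z ≤ K.indicator (fun z => F ‖z‖) z := by
    intro z hz
    have hz1 : ‖z‖ < 1 := mem_ball_zero_iff.1 hz
    by_cases hzS : z ∈ S
    swap
    · simp [hzS]
    have hzS' : ‖1 - (inner ℂ ξ z : ℂ)‖ < t := hzS
    have hin := norm_inner_le_norm (z := z) hξ
    have h1 : 1 - ‖z‖ ≤ ‖1 - (inner ℂ ξ z : ℂ)‖ := by
      have := norm_sub_norm_le (1 : ℂ) (inner ℂ ξ z)
      rw [norm_one] at this
      linarith
    have h2 : ‖inner ℂ ξ z - (‖z‖ : ℂ)‖ ≤ 2 * ‖1 - (inner ℂ ξ z : ℂ)‖ := by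
      have e1 : (inner ℂ ξ z : ℂ) - (‖z‖ : ℂ) = -(1 - inner ℂ ξ z) + ((1 - ‖z‖ : ℝ) : ℂ) := by
        push_cast; ring
      rw [e1]
      refine (norm_add_le _ _).trans ?_
      rw [norm_neg, Complex.norm_real, Real.norm_of_nonneg (by linarith)]
      linarith
    have hzK : z ∈ K := by
      simp only [hK, Set.mem_ofPred_eq]
      -- For `t ≥ 1/2` the cone condition is the trivial bound `2|z| ≤ 4t|z|`. For `t < 1/2`, `|z| >
      -- 1/2` gives `2t ≤ 4t|z|`. This is the origin of the aperture `4t`.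
      rcases le_or_gt (1 / 2) t with h | h
      · have := norm_sub_le (inner ℂ ξ z : ℂ) (‖z‖ : ℂ)
        rw [Complex.norm_real, norm_norm] at this
        have := norm_nonneg z
        nlinarith
      · nlinarith
    have hI : ‖z‖ ∈ Set.Ioo (1 - t) 1 := ⟨by linarith, hz1⟩
    rw [Set.indicator_of_mem hzS, Set.indicator_of_mem hzK, hF, Set.indicator_of_mem hI,
      Pi.one_apply, mul_one, hA, mul_assoc]
    have := (weightConst_pos (N := N) hα).le
    have := one_sub_sq_rpow_le (α := α) (norm_nonneg z) hz1
    gcongr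
  have hrad : ∫⁻ r in Set.Ioi (0 : ℝ), ENNReal.ofReal (r ^ (d - 1)) * F r ≤
      ENNReal.ofReal (A * (t ^ (α + 1) / (α + 1))) := by
    calc _ ≤ ∫⁻ r in Set.Ioi (0 : ℝ), F r := by
          refine setLIntegral_mono' measurableSet_Ioi fun r hr => ?_
          by_cases hI : r ∈ Set.Ioo (1 - t) 1
          · refine mul_le_of_le_one_left (zero_le) ?_
            rw [ENNReal.ofReal_le_one]
            exact pow_le_one₀ (le_of_lt hr) hI.2.le
          · simp [hF, hI]
      _ ≤ ∫⁻ r, F r := setLIntegral_le_lintegral _ _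
      _ = _ := by
          rw [hF, lintegral_indicator measurableSet_Ioo]
          simp_rw [ENNReal.ofReal_mul hA0.le]
          rw [lintegral_const_mul _ (by fun_prop), lintegral_one_sub_rpow hα ht]
  rw [← lintegral_indicator_one hSm, lintegral_weightedVolume (measurable_one.indicator hSm)]
  calc _ ≤ (volume (unitBall N))⁻¹ * ∫⁻ z in unitBall N, K.indicator (fun z => F ‖z‖) z := by
        gcongr 1
        exact setLIntegral_mono' measurableSet_unitBall hpt
    _ ≤ (volume (unitBall N))⁻¹ * ∫⁻ z in K, F ‖z‖ := by
        gcongr 1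
        rw [← lintegral_indicator hKm]
        exact setLIntegral_le_lintegral _ _
    _ ≤ (volume (unitBall N))⁻¹ * (d * ENNReal.ofReal (C * (4 * t) ^ N) *
          ENNReal.ofReal (A * (t ^ (α + 1) / (α + 1)))) := by
        gcongr 1
        refine (setLIntegral_cone_le volume hKm hKc hFm).trans ?_
        gcongr
        exact hcone ξ hξ (4 * t) (by positivity)
    _ = ENNReal.ofReal (V⁻¹ * (d * (C * (4 * t) ^ N) * (A * (t ^ (α + 1) / (α + 1))))) := by
        have hB : 0 ≤ A * (t ^ (α + 1) / (α + 1)) := by positivity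
        rw [ENNReal.ofReal_mul (p := V⁻¹) (by positivity),
          ENNReal.ofReal_mul (p := d * (C * (4 * t) ^ N)) (by positivity),
          ENNReal.ofReal_mul (p := d) (by positivity), ENNReal.ofReal_inv_of_pos hV0, hV,
          ENNReal.ofReal_toReal volume_unitBall_ne_top, ENNReal.ofReal_natCast]
    _ ≤ _ := by
        refine ENNReal.ofReal_le_ofReal ?_
        have e : t ^ ((N : ℝ) + 1 + α) = t ^ N * t ^ (α + 1) := by
          rw [add_assoc, Real.rpow_add ht, Real.rpow_natCast, add_comm 1 α]
        rw [e, mul_pow]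
        have h0 : 0 ≤ t ^ N * t ^ (α + 1) := by positivity
        calc _ = V⁻¹ * (d * (C * 4 ^ N) * (A / (α + 1))) * (t ^ N * t ^ (α + 1)) := by
              field_simp
          _ ≤ _ := by gcongr; linarith

/-- The integral over the ball of a power of the kernel `h / (1 + h - ⟨ξ, z⟩)`. -/
theorem exists_lintegral_kernel_le (N : ℕ) [NeZero N] (hα : -1 < α) {k : ℕ}
    (hk : (N : ℝ) + 1 + α + 1 ≤ k) :
    ∃ C : ℝ, 0 < C ∧ ∀ ξ ∈ unitSphere N, ∀ h : ℝ, 0 < h →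
      ∫⁻ z, ENNReal.ofReal ((h / ‖1 + (h : ℂ) - inner ℂ ξ z‖) ^ k) ∂weightedVolume N α ≤
        ENNReal.ofReal (C * h ^ ((N : ℝ) + 1 + α)) := by
  obtain ⟨C, hC, H⟩ := exists_weightedVolume_le N hα
  set d : ℝ := (N : ℝ) + 1 + α with hd
  refine ⟨C * 2 ^ d * 2, by positivity, fun ξ hξ h hh => ?_⟩
  -- Dyadic decomposition: at the first `j` with `z ∈ S j`, the kernel quotient is at most `2 ^
  -- (-j)`.
  set S : ℕ → Set (EuclideanSpace ℂ (Fin N)) :=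
    fun j => {z | ‖1 - (inner ℂ ξ z : ℂ)‖ < 2 ^ (j + 1) * h} with hS
  have hSm : ∀ j, MeasurableSet (S j) := fun j =>
    (isOpen_lt (by fun_prop) (by fun_prop)).measurableSet
  have hpt : ∀ z ∈ unitBall N, ENNReal.ofReal ((h / ‖1 + (h : ℂ) - inner ℂ ξ z‖) ^ k) ≤
      ∑' j, ENNReal.ofReal ((1 / 2) ^ (j * k)) * (S j).indicator 1 z := by
    intro z hz
    have hz1 : ‖z‖ < 1 := mem_ball_zero_iff.1 hz
    have hin := norm_inner_le_norm (z := z) hξ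
    have hre : (inner ℂ ξ z : ℂ).re < 1 := (Complex.re_le_norm _).trans_lt (by linarith)
    have hex : ∃ j : ℕ, z ∈ S j := by
      obtain ⟨j, hj⟩ := pow_unbounded_of_one_lt (‖1 - (inner ℂ ξ z : ℂ)‖ / h)
        (one_lt_two (α := ℝ))
      refine ⟨j, ?_⟩
      rw [div_lt_iff₀ hh] at hj
      simp only [hS, Set.mem_ofPred_eq]
      refine hj.trans_le ?_
      gcongr <;> simp
    classical
    have hj := Nat.find_spec hex
    refine le_trans ?_ (ENNReal.le_tsum (Nat.find hex))
    rw [Set.indicator_of_mem hj, Pi.one_apply, mul_one, pow_mul]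
    have hlow1 : h ≤ ‖1 + (h : ℂ) - inner ℂ ξ z‖ := by
      refine le_trans ?_ (Complex.re_le_norm _)
      simp; linarith
    have hlow2 : ‖1 - (inner ℂ ξ z : ℂ)‖ ≤ ‖1 + (h : ℂ) - inner ℂ ξ z‖ := by
      -- Adding `h > 0` to a complex number of positive real part increases its modulus.
      rw [← pow_le_pow_iff_left₀ (norm_nonneg _) (norm_nonneg _) two_ne_zero, Complex.sq_norm,
        Complex.sq_norm, Complex.normSq_apply, Complex.normSq_apply]
      simp only [Complex.sub_re, Complex.add_re, Complex.sub_im, Complex.add_im, Complex.one_re,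
        Complex.one_im, Complex.ofReal_re, Complex.ofReal_im]
      nlinarith
    have hpos := hh.trans_le hlow1
    gcongr
    rw [div_le_iff₀ hpos]
    rcases Nat.eq_zero_or_pos (Nat.find hex) with h0 | h0
    · rw [h0]; simpa using hlow1
    · have hmin := Nat.find_min hex (Nat.sub_one_lt h0.ne')
      simp only [hS, Set.mem_ofPred_eq, not_lt, Nat.sub_add_cancel h0] at hmin
      have : h = (1 / 2) ^ (Nat.find hex) * (2 ^ Nat.find hex * h) := by
        rw [← mul_assoc, ← mul_pow]; simp
      calc h = (1 / 2) ^ (Nat.find hex) * (2 ^ Nat.find hex * h) := this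
        _ ≤ _ := by gcongr; exact hmin.trans hlow2
  calc _ ≤ ∫⁻ z, ∑' j, ENNReal.ofReal ((1 / 2) ^ (j * k)) * (S j).indicator 1 z
          ∂weightedVolume N α := lintegral_mono_ae (ae_mem_unitBall.mono hpt)
    _ = ∑' j, ENNReal.ofReal ((1 / 2) ^ (j * k)) * weightedVolume N α (S j) := by
        rw [lintegral_tsum fun j =>
          ((measurable_one.indicator (hSm j)).const_mul _).aemeasurable]
        refine tsum_congr fun j => ?_
        rw [lintegral_const_mul _ (measurable_one.indicator (hSm j)),
          lintegral_indicator_one (hSm j)]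
    _ ≤ ∑' j : ℕ, ENNReal.ofReal (C * 2 ^ d * h ^ d * (1 / 2) ^ j) := by
        refine ENNReal.tsum_le_tsum fun j => ?_
        refine (mul_le_mul_right (H ξ hξ (2 ^ (j + 1) * h) (by positivity)) _).trans ?_
        rw [← ENNReal.ofReal_mul (by positivity)]
        refine ENNReal.ofReal_le_ofReal ?_
        have e1 : ((2 : ℝ) ^ (j + 1) * h) ^ d = 2 ^ d * h ^ d * (2 : ℝ) ^ (j * d) := by
          rw [Real.mul_rpow (by positivity) hh.le, pow_succ,
            Real.mul_rpow (by positivity) (by positivity), ← Real.rpow_natCast,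
            ← Real.rpow_mul (by positivity)]
          ring
        -- Here `k ≥ d + 1` leaves a convergent geometric series after the growth `2 ^ (jd)` of the
        -- volumes.
        have e2 : ((1 : ℝ) / 2) ^ (j * k) * (2 : ℝ) ^ (j * d) ≤ (1 / 2) ^ j := by
          have : ∀ m : ℕ, ((1 : ℝ) / 2) ^ m = (2 : ℝ) ^ (-(m : ℝ)) := fun m => by
            rw [Real.rpow_neg (by norm_num), Real.rpow_natCast, one_div, inv_pow]
          rw [this, this, ← Real.rpow_add (by norm_num)]
          refine Real.rpow_le_rpow_of_exponent_le (by norm_num) ?_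
          have : (0 : ℝ) ≤ j := Nat.cast_nonneg j
          push_cast
          nlinarith
        rw [e1]
        have h0 : 0 ≤ C * 2 ^ d * h ^ d := by positivity
        nlinarith
    _ = _ := by
        rw [← ENNReal.ofReal_tsum_of_nonneg (fun j => by positivity)
          (summable_geometric_two.mul_left _), tsum_mul_left, tsum_geometric_two]
        congr 1
        ring

/-! ### The sub-mean value property on nonisotropic ellipsoids. -/

variable {ψ : ℝ → ℝ}

/-- The nonisotropic ellipsoid of size comparable with the distance from `z` to the sphere,
centred at `0`. -/
def ellipsoid (z : EuclideanSpace ℂ (Fin N)) : Set (EuclideanSpace ℂ (Fin N)) :=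
  {u | ‖(inner ℂ z u : ℂ)‖ < 1 / 8 * (1 - ‖z‖ ^ 2) ∧ ‖u‖ ^ 2 < (1 / 8) ^ 2 * (1 - ‖z‖ ^ 2)}

/-- The modular density `ψ(|g|)`, extended by zero off the ball. -/
def orliczDensity (ψ : ℝ → ℝ) (g : EuclideanSpace ℂ (Fin N) → ℂ) :
    EuclideanSpace ℂ (Fin N) → ℝ≥0∞ :=
  (unitBall N).indicator fun z => ENNReal.ofReal (ψ ‖g z‖)

theorem orliczDensity_of_mem {g : EuclideanSpace ℂ (Fin N) → ℂ} {z : EuclideanSpace ℂ (Fin N)}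
    (hz : z ∈ unitBall N) : orliczDensity ψ g z = ENNReal.ofReal (ψ ‖g z‖) :=
  Set.indicator_of_mem hz _

theorem measurable_orliczDensity (hψ : IsOrliczFunction ψ) {g : EuclideanSpace ℂ (Fin N) → ℂ}
    (hg : ContinuousOn g (unitBall N)) : Measurable (orliczDensity ψ g) := by
  have hc : ContinuousOn (fun z => ENNReal.ofReal (ψ ‖g z‖)) (unitBall N) :=
    ENNReal.continuous_ofReal.comp_continuousOn
      (hψ.continuousOn.comp hg.norm fun z _ => norm_nonneg _)
  classical
  rw [orliczDensity, ← Set.piecewise_eq_indicator]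
  exact hc.measurable_piecewise continuousOn_const measurableSet_unitBall

theorem one_sub_norm_sq_pos {z : EuclideanSpace ℂ (Fin N)} (hz : z ∈ unitBall N) :
    0 < 1 - ‖z‖ ^ 2 := by
  have h1 : ‖z‖ < 1 := mem_ball_zero_iff.1 hz
  have := norm_nonneg z
  nlinarith

theorem exists_unitSphere_smul [NeZero N] (z : EuclideanSpace ℂ (Fin N)) :
    ∃ ξ ∈ unitSphere N, z = (‖z‖ : ℂ) • ξ := by
  rcases eq_or_ne z 0 with rfl | hz
  · exact ⟨EuclideanSpace.single 0 1, by simp [unitSphere], by simp⟩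
  · have hz' : (‖z‖ : ℂ) ≠ 0 := by simpa using hz
    refine ⟨(‖z‖⁻¹ : ℂ) • z, ?_, by rw [smul_inv_smul₀ hz']⟩
    rw [unitSphere, mem_sphere_zero_iff_norm, norm_smul]
    simp [hz]

theorem exists_le_volume_ellipsoid (N : ℕ) [NeZero N] : ∃ c : ℝ, 0 < c ∧
    ∀ z ∈ unitBall N, ENNReal.ofReal (c * (1 - ‖z‖ ^ 2) ^ (N + 1)) ≤ volume (ellipsoid z) := by
  obtain ⟨c, hc, H⟩ := exists_le_volume_nonisotropic_ball N (a := 1 / 8) (by norm_num)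
  refine ⟨c, hc, fun z hz => ?_⟩
  obtain ⟨ξ, hξ, hzξ⟩ := exists_unitSphere_smul z
  have h1 : ‖z‖ < 1 := mem_ball_zero_iff.1 hz
  refine (H ξ hξ _ (one_sub_norm_sq_pos hz) (by simp)).trans (measure_mono fun u hu => ?_)
  refine ⟨?_, hu.2⟩
  have : ‖(inner ℂ z u : ℂ)‖ = ‖z‖ * ‖(inner ℂ ξ u : ℂ)‖ := by
    conv_lhs => rw [hzξ]
    rw [inner_smul_left, norm_mul, RCLike.norm_conj, Complex.norm_real, norm_norm]
  rw [this]
  refine lt_of_le_of_lt ?_ hu.1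
  exact mul_le_of_le_one_left (norm_nonneg _) h1.le

/-- Expanding `|z + u|²`, the perturbation is at most `(2/8 + 1/64)(1 - |z|²)`, less than half of `1
- |z|²`. -/
theorem one_sub_norm_sq_bounds {z u : EuclideanSpace ℂ (Fin N)} (hu : u ∈ ellipsoid z) :
    (1 - ‖z‖ ^ 2) / 2 ≤ 1 - ‖z + u‖ ^ 2 ∧ 1 - ‖z + u‖ ^ 2 ≤ 2 * (1 - ‖z‖ ^ 2) := by
  obtain ⟨h1, h2⟩ := hu
  have e := norm_add_sq (𝕜 := ℂ) z u
  have hre := (RCLike.abs_re_le_norm (inner ℂ z u : ℂ)).trans h1.le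
  rw [abs_le] at hre
  have := sq_nonneg ‖u‖
  rw [e]
  constructor <;> linarith [hre.1, hre.2]

theorem add_mem_unitBall {z u : EuclideanSpace ℂ (Fin N)} (hz : z ∈ unitBall N)
    (hu : u ∈ ellipsoid z) : z + u ∈ unitBall N := by
  have := (one_sub_norm_sq_bounds hu).1
  have := one_sub_norm_sq_pos hz
  rw [unitBall, mem_ball_zero_iff]
  have := norm_nonneg (z + u)
  nlinarith

/-- The ellipsoid is balanced, so it contains the whole complex disc through each of its points;
slicing by circles depends on this. -/
theorem smul_mem_ellipsoid {z u : EuclideanSpace ℂ (Fin N)} (hu : u ∈ ellipsoid z) {a : ℂ}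
    (ha : ‖a‖ ≤ 1) : a • u ∈ ellipsoid z := by
  refine ⟨lt_of_le_of_lt ?_ hu.1, lt_of_le_of_lt ?_ hu.2⟩
  · rw [inner_smul_right, norm_mul]
    exact mul_le_of_le_one_left (norm_nonneg _) ha
  · rw [norm_smul]
    gcongr
    exact mul_le_of_le_one_left (norm_nonneg _) ha

theorem isOpen_ellipsoid (z : EuclideanSpace ℂ (Fin N)) : IsOpen (ellipsoid z) := by
  have h1 : IsOpen {u : EuclideanSpace ℂ (Fin N) |
      ‖(inner ℂ z u : ℂ)‖ < 1 / 8 * (1 - ‖z‖ ^ 2)} := isOpen_lt (by fun_prop) (by fun_prop)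
  have h2 : IsOpen {u : EuclideanSpace ℂ (Fin N) |
      ‖u‖ ^ 2 < (1 / 8) ^ 2 * (1 - ‖z‖ ^ 2)} := isOpen_lt (by fun_prop) (by fun_prop)
  exact h1.inter h2

/-- The sub-mean value property of `ψ(|g|)` on circles. -/
theorem orliczDensity_le_circle (hψ : IsOrliczFunction ψ) {g : EuclideanSpace ℂ (Fin N) → ℂ}
    (hg : DifferentiableOn ℂ g (unitBall N)) {z u : EuclideanSpace ℂ (Fin N)}
    (hz : z ∈ unitBall N) (hu : u ∈ ellipsoid z) :
    ENNReal.ofReal (2 * Real.pi) * orliczDensity ψ g z ≤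
      ∫⁻ θ in Set.Ioc 0 (2 * Real.pi), orliczDensity ψ g (z + circleMap 0 1 θ • u) := by
  have hpi := Real.two_pi_pos
  -- The restriction of `g` to the complex line through `z` in direction `u` is holomorphic near no
  -- more than the closed unit disc, which suffices for the mean value property; Jensen then inserts
  -- `ψ`.
  set φ : ℂ → ℂ := fun ζ => g (z + ζ • u) with hφ
  have hmem : ∀ ζ : ℂ, ‖ζ‖ ≤ 1 → z + ζ • u ∈ unitBall N := fun ζ hζ =>
    add_mem_unitBall hz (smul_mem_ellipsoid hu hζ)
  have hφd : DifferentiableOn ℂ φ (Metric.closedBall 0 |1|) := by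
    refine hg.comp (by fun_prop) fun ζ hζ => hmem ζ ?_
    simpa using hζ
  have hav := (hφd.diffContOnCl_ball subset_rfl).circleAverage
  set f : ℝ → ℝ := fun θ => ‖φ (circleMap 0 1 θ)‖ with hf
  have hcirc : ∀ θ, circleMap 0 1 θ ∈ Metric.closedBall (0 : ℂ) |1| := fun θ => by simp
  have hφc : Continuous fun θ => φ (circleMap 0 1 θ) :=
    hφd.continuousOn.comp_continuous (continuous_circleMap 0 1) hcirc
  have hfc : Continuous f := hφc.norm
  have hψf : Continuous fun θ => ψ (f θ) := hψ.continuous_comp hfc fun _ => norm_nonneg _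
  have hvol : (volume (Set.Ioc 0 (2 * Real.pi))).toReal = 2 * Real.pi := by
    simp [Real.volume_Ioc, Real.pi_pos.le]
  have h1 : ‖g z‖ ≤ ⨍ θ in Set.Ioc 0 (2 * Real.pi), f θ := by
    have e : g z = φ 0 := by simp [hφ]
    rw [e, ← hav, Real.circleAverage_def, norm_smul, setAverage_eq, measureReal_def, hvol,
      Real.norm_of_nonneg (by positivity), smul_eq_mul, ← intervalIntegral.integral_of_le hpi.le]
    gcongr
    exact intervalIntegral.norm_integral_le_integral_norm hpi.le
  have hJ : ψ (⨍ θ in Set.Ioc 0 (2 * Real.pi), f θ) ≤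
      ⨍ θ in Set.Ioc 0 (2 * Real.pi), ψ (f θ) := by
    refine hψ.strictConvexOn.convexOn.map_set_average_le hψ.continuousOn isClosed_Ici ?_ ?_ ?_
      hfc.integrableOn_Ioc hψf.integrableOn_Ioc
    · simp [Real.pi_pos]
    · simp [Real.volume_Ioc, ENNReal.mul_eq_top]
    · exact ae_of_all _ fun θ => norm_nonneg _
  have h2 := (hψ.mono (norm_nonneg _) h1).trans hJ
  rw [setAverage_eq, measureReal_def, hvol, smul_eq_mul, ← div_eq_inv_mul, le_div_iff₀ hpi,
    mul_comm] at h2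
  rw [orliczDensity_of_mem hz, ← ENNReal.ofReal_mul hpi.le]
  refine (ENNReal.ofReal_le_ofReal h2).trans_eq ?_
  rw [ofReal_integral_eq_lintegral_ofReal hψf.integrableOn_Ioc
    (ae_of_all _ fun θ => hψ.nonneg _ (norm_nonneg _))]
  refine lintegral_congr fun θ => ?_
  rw [orliczDensity_of_mem (hmem _ (by simp))]

/-- The nonisotropic neighbourhood of `z`. -/
def nonisotropicNhd (z : EuclideanSpace ℂ (Fin N)) : Set (EuclideanSpace ℂ (Fin N)) :=
  {w | w - z ∈ ellipsoid z}

/-- Multiplication by a unimodular scalar preserves both Lebesgue measure and the ellipsoid, so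
every angle of the circle contributes the same integral. -/
theorem lintegral_ellipsoid_rotate (z : EuclideanSpace ℂ (Fin N)) {a : ℂ} (ha : ‖a‖ = 1)
    {G : EuclideanSpace ℂ (Fin N) → ℝ≥0∞} (hG : Measurable G) :
    ∫⁻ u in ellipsoid z, G (z + a • u) = ∫⁻ w in nonisotropicNhd z, G w := by
  have ha0 : a ≠ 0 := by
    rintro rfl
    simp at ha
  let e : EuclideanSpace ℂ (Fin N) ≃ₗᵢ[ℝ] EuclideanSpace ℂ (Fin N) :=
    { (LinearEquiv.smulOfNeZero ℂ (EuclideanSpace ℂ (Fin N)) a ha0).restrictScalars ℝ with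
      norm_map' := fun u => by
        change ‖a • u‖ = ‖u‖
        rw [norm_smul, ha, one_mul] }
  have he : ∀ u, e u = a • u := fun u => rfl
  have hm : MeasurableSet (ellipsoid z) := (isOpen_ellipsoid z).measurableSet
  have hm' : MeasurableSet (nonisotropicNhd z) :=
    (measurable_sub_const z) hm
  set F := (nonisotropicNhd z).indicator G with hF
  have hFm : Measurable F := hG.indicator hm'
  calc _ = ∫⁻ u, F (z + e u) := by
        rw [← lintegral_indicator hm]
        refine lintegral_congr fun u => ?_
        have hiff : z + e u ∈ nonisotropicNhd z ↔ u ∈ ellipsoid z := by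
          simp only [nonisotropicNhd, Set.mem_ofPred_eq, add_sub_cancel_left, he]
          refine ⟨fun h => ?_, fun h => smul_mem_ellipsoid h ha.le⟩
          have := smul_mem_ellipsoid (a := a⁻¹) h (by simp [ha])
          rwa [inv_smul_smul₀ ha0] at this
        by_cases hu : u ∈ ellipsoid z
        · rw [Set.indicator_of_mem hu, hF, Set.indicator_of_mem (hiff.2 hu), he]
        · rw [Set.indicator_of_notMem hu, hF, Set.indicator_of_notMem (mt hiff.1 hu)]
    _ = ∫⁻ u, F (z + u) :=
        e.measurePreserving.lintegral_comp (f := fun u => F (z + u)) (by fun_prop)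
    _ = ∫⁻ w, F w := lintegral_add_left_eq_self F z
    _ = _ := lintegral_indicator hm' _

/-- The circle inequality is integrated over all `u` in the ellipsoid; after Tonelli, rotation
invariance makes the angular integral a factor `2π` that cancels. -/
theorem mul_volume_ellipsoid_le (hψ : IsOrliczFunction ψ) {g : EuclideanSpace ℂ (Fin N) → ℂ}
    (hg : DifferentiableOn ℂ g (unitBall N)) {z : EuclideanSpace ℂ (Fin N)}
    (hz : z ∈ unitBall N) :
    volume (ellipsoid z) * orliczDensity ψ g z ≤
      ∫⁻ w in nonisotropicNhd z, orliczDensity ψ g w := by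
  have hG := measurable_orliczDensity hψ hg.continuousOn
  have hpi : ENNReal.ofReal (2 * Real.pi) ≠ 0 := by simp [Real.pi_pos]
  have hm : MeasurableSet (ellipsoid z) := (isOpen_ellipsoid z).measurableSet
  rw [← ENNReal.mul_le_mul_iff_right hpi ENNReal.ofReal_ne_top]
  calc _ = ∫⁻ _u in ellipsoid z, ENNReal.ofReal (2 * Real.pi) * orliczDensity ψ g z := by
        rw [setLIntegral_const]; ring
    _ ≤ ∫⁻ u in ellipsoid z, ∫⁻ θ in Set.Ioc 0 (2 * Real.pi),
          orliczDensity ψ g (z + circleMap 0 1 θ • u) :=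
        setLIntegral_mono' hm fun u hu => orliczDensity_le_circle hψ hg hz hu
    _ = ∫⁻ θ in Set.Ioc 0 (2 * Real.pi), ∫⁻ u in ellipsoid z,
          orliczDensity ψ g (z + circleMap 0 1 θ • u) := by
        refine lintegral_lintegral_swap (Measurable.aemeasurable ?_)
        refine hG.comp (Continuous.measurable ?_)
        have := (continuous_circleMap 0 1)
        fun_prop
    _ = ∫⁻ _θ in Set.Ioc 0 (2 * Real.pi), ∫⁻ w in nonisotropicNhd z, orliczDensity ψ g w :=
        lintegral_congr fun θ => lintegral_ellipsoid_rotate z (by simp) hG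
    _ = _ := by
        rw [setLIntegral_const, Real.volume_Ioc, sub_zero, mul_comm]

theorem half_rpow_le {h s : ℝ} (hh : 0 < h) (h1 : h / 2 ≤ s) (h2 : s ≤ 2 * h) :
    2 ^ (-|α|) * h ^ α ≤ s ^ α := by
  have hs : 0 < s := by linarith
  have hq : (2 : ℝ) ^ (-|α|) ≤ (s / h) ^ α := by
    have l1 : 1 / 2 ≤ s / h := by rw [le_div_iff₀ hh]; linarith
    have l2 : s / h ≤ 2 := by rw [div_le_iff₀ hh]; linarith
    rcases le_total 0 α with ha | ha
    · rw [abs_of_nonneg ha, Real.rpow_neg (by norm_num), ← Real.inv_rpow (by norm_num)]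
      refine Real.rpow_le_rpow (by norm_num) ?_ ha
      linarith
    · rw [abs_of_nonpos ha, neg_neg]
      exact Real.rpow_le_rpow_of_nonpos (by positivity) l2 ha
  rw [Real.div_rpow hs.le hh.le, le_div_iff₀ (by positivity)] at hq
  exact hq

/-- The sub-mean value property of `ψ(|g|)` with respect to the weighted volume. -/
theorem exists_orliczDensity_le (N : ℕ) [NeZero N] (hα : -1 < α) : ∃ C : ℝ, 0 < C ∧
    ∀ ψ : ℝ → ℝ, IsOrliczFunction ψ → ∀ g : EuclideanSpace ℂ (Fin N) → ℂ,
      DifferentiableOn ℂ g (unitBall N) → ∀ z ∈ unitBall N,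
        orliczDensity ψ g z ≤ ENNReal.ofReal (C / (1 - ‖z‖ ^ 2) ^ ((N : ℝ) + 1 + α)) *
          ∫⁻ w in nonisotropicNhd z, orliczDensity ψ g w ∂weightedVolume N α := by
  obtain ⟨c, hc, H⟩ := exists_le_volume_ellipsoid N
  set V : ℝ := (volume (unitBall N)).toReal with hV
  have hV0 : 0 < V := ENNReal.toReal_pos volume_unitBall_ne_zero volume_unitBall_ne_top
  have hw := weightConst_pos (N := N) hα
  -- On the neighbourhood of `z`, the density of `v_α` is at least `κ (1 - |z|²) ^ α`.
  set κ : ℝ := V⁻¹ * (weightConst N α * 2 ^ (-|α|)) with hκ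
  have hκ0 : 0 < κ := by positivity
  refine ⟨1 / (κ * c), by positivity, fun ψ hψ g hg z hz => ?_⟩
  set h := 1 - ‖z‖ ^ 2 with hh
  have hh0 : 0 < h := one_sub_norm_sq_pos hz
  have hG := measurable_orliczDensity hψ hg.continuousOn
  have hm' : MeasurableSet (nonisotropicNhd z) :=
    (measurable_sub_const z) (isOpen_ellipsoid z).measurableSet
  have hsub : ∀ w ∈ nonisotropicNhd z, w ∈ unitBall N ∧
      2 ^ (-|α|) * h ^ α ≤ (1 - ‖w‖ ^ 2) ^ α := by
    intro w hwz
    have hwz' : w - z ∈ ellipsoid z := hwz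
    have hb := one_sub_norm_sq_bounds hwz'
    have hmem := add_mem_unitBall hz hwz'
    rw [add_sub_cancel] at hb hmem
    exact ⟨hmem, half_rpow_le hh0 hb.1 hb.2⟩
  have hA := (mul_le_mul_left (H z hz) (orliczDensity ψ g z)).trans
    (mul_volume_ellipsoid_le hψ hg hz)
  have hB : ENNReal.ofReal (κ * h ^ α) * ∫⁻ w in nonisotropicNhd z, orliczDensity ψ g w ≤
      ∫⁻ w in nonisotropicNhd z, orliczDensity ψ g w ∂weightedVolume N α := by
    rw [← lintegral_indicator hm', ← lintegral_indicator hm',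
      lintegral_weightedVolume (hG.indicator hm'), hκ, mul_assoc,
      ENNReal.ofReal_mul (inv_nonneg.2 hV0.le), ENNReal.ofReal_inv_of_pos hV0, hV,
      ENNReal.ofReal_toReal volume_unitBall_ne_top, mul_assoc]
    gcongr 1
    rw [← lintegral_const_mul _ (hG.indicator hm'), ← lintegral_indicator measurableSet_unitBall]
    refine lintegral_mono fun w => ?_
    by_cases hwD : w ∈ nonisotropicNhd z
    · obtain ⟨h1, h2⟩ := hsub w hwD
      simp only [Set.indicator_of_mem hwD, Set.indicator_of_mem h1]
      gcongr 2
      rw [mul_assoc]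
      gcongr
    · simp [hwD]
  have hd : h ^ ((N : ℝ) + 1 + α) = h ^ (N + 1) * h ^ α := by
    rw [Real.rpow_add hh0, ← Nat.cast_succ, Real.rpow_natCast]
  calc orliczDensity ψ g z
      = ENNReal.ofReal (1 / (κ * c) / h ^ ((N : ℝ) + 1 + α)) *
          (ENNReal.ofReal (κ * h ^ α) * (ENNReal.ofReal (c * h ^ (N + 1)) *
            orliczDensity ψ g z)) := by
        rw [← mul_assoc, ← mul_assoc, ← ENNReal.ofReal_mul (by positivity),
          ← ENNReal.ofReal_mul (by positivity), hd]
        have : 1 / (κ * c) / (h ^ (N + 1) * h ^ α) * (κ * h ^ α) * (c * h ^ (N + 1)) = 1 := by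
          have := (Real.rpow_pos_of_pos hh0 α).ne'
          field_simp
        rw [this, ENNReal.ofReal_one, one_mul]
    _ ≤ _ := by
        gcongr
        exact (mul_le_mul_right hA _).trans hB

/-! ### The Carleson embedding near the boundary. -/

/-- Inverts the relation `w ∈ D(z)` for use after Tonelli. With `δ = 1 - |z|²`, the angular distance
is at most `2(3 + 9/8)δ`, below `10δ ≤ 20(1 - |w|²)`. -/
theorem mem_carlesonWindow {z w : EuclideanSpace ℂ (Fin N)} (hz : z ∈ unitBall N)
    (hz1 : 7 / 8 ≤ ‖z‖ ^ 2) (hw : w ∈ nonisotropicNhd z) :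
    (‖w‖⁻¹ : ℂ) • w ∈ unitSphere N ∧
      z ∈ carlesonWindow ((‖w‖⁻¹ : ℂ) • w) (20 * (1 - ‖w‖ ^ 2)) := by
  have hw' : w - z ∈ ellipsoid z := hw
  have hb := one_sub_norm_sq_bounds hw'
  rw [add_sub_cancel] at hb
  have hzlt : ‖z‖ < 1 := mem_ball_zero_iff.1 hz
  have hz0 := norm_nonneg z
  have hw0 := norm_nonneg w
  have hδ := one_sub_norm_sq_pos hz
  have hwsq : 3 / 4 ≤ ‖w‖ ^ 2 := by linarith
  have hwpos : 0 < ‖w‖ := by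
    by_contra h
    have : ‖w‖ = 0 := le_antisymm (not_lt.1 h) hw0
    rw [this] at hwsq; norm_num at hwsq
  have hzpos : 0 < ‖z‖ := by
    by_contra h
    have : ‖z‖ = 0 := le_antisymm (not_lt.1 h) hz0
    rw [this] at hz1; norm_num at hz1
  have hwlt : ‖w‖ < 1 := by nlinarith
  have hp : 1 / 2 ≤ ‖w‖ * ‖z‖ := by
    have : (3 / 4) * (7 / 8) ≤ ‖w‖ ^ 2 * ‖z‖ ^ 2 := by gcongr
    nlinarith [mul_pos hwpos hzpos]
  have hp1 : ‖w‖ * ‖z‖ ≤ 1 := by nlinarith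
  have hin : ‖1 - (inner ℂ w z : ℂ)‖ ≤ 9 / 8 * (1 - ‖z‖ ^ 2) := by
    have e : 1 - (inner ℂ z w : ℂ) = ((1 - ‖z‖ ^ 2 : ℝ) : ℂ) - inner ℂ z (w - z) := by
      rw [inner_sub_right, inner_self_eq_norm_sq_to_K]
      push_cast
      simp
    rw [← RCLike.norm_conj, map_sub, map_one, inner_conj_symm, e]
    refine (norm_sub_le _ _).trans ?_
    rw [Complex.norm_real, Real.norm_of_nonneg hδ.le]
    linarith [hw'.1]
  refine ⟨?_, hz, by nlinarith, ?_⟩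
  · rw [unitSphere, mem_sphere_zero_iff_norm, norm_smul]
    simp [hwpos.ne']
  · rw [nonisotropicDist, Real.sq_sqrt (norm_nonneg _), inner_smul_left, inner_smul_right]
    have e : 1 - (starRingEnd ℂ) (‖w‖ : ℂ)⁻¹ * ((‖z‖ : ℂ)⁻¹ * inner ℂ w z) =
        ((‖w‖ * ‖z‖ : ℝ) : ℂ)⁻¹ * (((‖w‖ * ‖z‖ - 1 : ℝ) : ℂ) + (1 - inner ℂ w z)) := by
      have h1 : (‖w‖ : ℂ) ≠ 0 := by exact_mod_cast hwpos.ne'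
      have h2 : (‖z‖ : ℂ) ≠ 0 := by exact_mod_cast hzpos.ne'
      rw [map_inv₀, Complex.conj_ofReal]
      push_cast
      field_simp
      ring
    rw [e, norm_mul, norm_inv, Complex.norm_real, Real.norm_of_nonneg (by positivity)]
    have h3 : ‖((‖w‖ * ‖z‖ - 1 : ℝ) : ℂ) + (1 - inner ℂ w z)‖ ≤
        (1 - ‖w‖ * ‖z‖) + 9 / 8 * (1 - ‖z‖ ^ 2) := by
      refine (norm_add_le _ _).trans ?_
      rw [Complex.norm_real, Real.norm_of_nonpos (by linarith)]
      linarith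
    have h4 : 1 - ‖w‖ * ‖z‖ ≤ 3 * (1 - ‖z‖ ^ 2) := by nlinarith
    have h5 : (‖w‖ * ‖z‖)⁻¹ ≤ 2 := by
      rw [inv_le_comm₀ (by positivity) (by norm_num)]; linarith
    calc _ ≤ 2 * ((1 - ‖w‖ * ‖z‖) + 9 / 8 * (1 - ‖z‖ ^ 2)) := by gcongr
      _ < _ := by linarith

theorem lintegral_orliczDensity (g : EuclideanSpace ℂ (Fin N) → ℂ) :
    ∫⁻ w, orliczDensity ψ g w ∂weightedVolume N α = modular ψ g (weightedVolume N α) 1 := by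
  refine lintegral_congr_ae ?_
  filter_upwards [ae_mem_unitBall] with z hz
  rw [orliczDensity_of_mem hz, div_one]

/-- Monotone functions are measurable; truncation at `0` makes the composite monotone on the whole
line, since `orliczInv` is meaningful only on `[0, ∞)`. -/
theorem measurable_comp_orliczInv (hψ : IsOrliczFunction ψ) {X : Type*} [MeasurableSpace X]
    {f : X → ℝ} (hf : Measurable f) {B : ℝ} (hB : 0 ≤ B) :
    Measurable fun x => ψ (B * orliczInv ψ (max (f x) 0)) := by
  have hm : Monotone fun t : ℝ => ψ (B * orliczInv ψ (max t 0)) := fun s t hst => by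
    have := hψ.orliczInv_nonneg (le_max_right s 0)
    refine hψ.mono (by positivity) ?_
    gcongr
    exact hψ.orliczInv_mono (le_max_right _ _) (max_le_max_right 0 hst)
  exact hm.measurable.comp hf

/-- Continuity from above: the shells decrease to a subset of the complement of the ball, which is
`μ`-null. -/
theorem tendsto_measure_norm_gt (μ : Measure (EuclideanSpace ℂ (Fin N))) [IsFiniteMeasure μ]
    (hμ : μ (unitBall N)ᶜ = 0) {ε : ℝ≥0∞} (hε : 0 < ε) {r₀ : ℝ} (hr₀ : r₀ < 1) :
    ∃ r, r₀ < r ∧ r < 1 ∧ μ {z | r < ‖z‖} < ε := by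
  set S : ℕ → Set (EuclideanSpace ℂ (Fin N)) := fun n => {z | 1 - 1 / ((n : ℝ) + 1) < ‖z‖} with hS
  have hSm : ∀ n, MeasurableSet (S n) := fun n =>
    (isOpen_lt continuous_const continuous_norm).measurableSet
  have hanti : Antitone S := by
    intro m n hmn z hz
    simp only [hS, Set.mem_ofPred_eq] at hz ⊢
    have : 1 / ((n : ℝ) + 1) ≤ 1 / ((m : ℝ) + 1) := by gcongr
    linarith
  have hlim := tendsto_measure_iInter_atTop (μ := μ) (fun n => (hSm n).nullMeasurableSet) hanti
    ⟨0, measure_ne_top _ _⟩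
  have h0 : μ (⋂ n, S n) = 0 := by
    refine measure_mono_null (fun z hz => ?_) hμ
    simp only [hS, Set.mem_iInter, Set.mem_ofPred_eq] at hz
    rw [Set.mem_compl_iff, unitBall, mem_ball_zero_iff, not_lt]
    have : Tendsto (fun n : ℕ => 1 - 1 / ((n : ℝ) + 1)) atTop (𝓝 (1 - 0)) :=
      tendsto_one_div_add_atTop_nhds_zero_nat.const_sub 1
    rw [sub_zero] at this
    exact le_of_tendsto' this fun n => (hz n).le
  rw [h0] at hlim
  have h1 : Tendsto (fun n : ℕ => 1 - 1 / ((n : ℝ) + 1)) atTop (𝓝 (1 - 0)) :=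
    tendsto_one_div_add_atTop_nhds_zero_nat.const_sub 1
  rw [sub_zero] at h1
  obtain ⟨n, hn1, hn2⟩ := ((h1.eventually_const_lt hr₀).and (hlim.eventually_lt_const hε)).exists
  exact ⟨_, hn1, by have : 0 < 1 / ((n : ℝ) + 1) := by positivity
                    linarith, hn2⟩

/-- Growth of functions in the unit ball of the Bergman-Orlicz space. -/
theorem exists_norm_le (N : ℕ) [NeZero N] (hα : -1 < α) : ∃ C : ℝ, 0 < C ∧
    ∀ ψ : ℝ → ℝ, IsOrliczFunction ψ → ∀ g : EuclideanSpace ℂ (Fin N) → ℂ,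
      DifferentiableOn ℂ g (unitBall N) → modular ψ g (weightedVolume N α) 1 ≤ 1 →
        ∀ z ∈ unitBall N,
          ‖g z‖ ≤ orliczInv ψ (C / (1 - ‖z‖ ^ 2) ^ ((N : ℝ) + 1 + α)) ∧
          ENNReal.ofReal (ψ ‖g z‖) ≤ ENNReal.ofReal (C / (1 - ‖z‖ ^ 2) ^ ((N : ℝ) + 1 + α)) *
            ∫⁻ w in nonisotropicNhd z, orliczDensity ψ g w ∂weightedVolume N α := by
  obtain ⟨C, hC, H⟩ := exists_orliczDensity_le N hα
  refine ⟨C, hC, fun ψ hψ g hg hmod z hz => ?_⟩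
  have h := H ψ hψ g hg z hz
  rw [orliczDensity_of_mem hz] at h
  refine ⟨hψ.le_orliczInv (norm_nonneg _) ?_, h⟩
  have hδ := one_sub_norm_sq_pos hz
  rw [← ENNReal.ofReal_le_ofReal_iff (by positivity)]
  refine h.trans (mul_le_of_le_one_right (zero_le) ?_)
  exact (setLIntegral_le_lintegral _ _).trans ((lintegral_orliczDensity g).trans_le hmod)

/-- The Carleson embedding estimate near the boundary. -/
theorem exists_setLIntegral_le [NeZero N] (hα : -1 < α) (hψ : IsOrliczFunction ψ)
    (hψ₀ : NablaZero ψ) (μ : Measure (EuclideanSpace ℂ (Fin N))) [IsFiniteMeasure μ]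
    (hμ : μ (unitBall N)ᶜ = 0) (hvan : IsVanishingBergmanCarleson N α ψ μ)
    {K ε : ℝ} (hK : 0 ≤ K) (hε : 0 < ε) :
    ∃ r : ℝ, r < 1 ∧ ∀ g : EuclideanSpace ℂ (Fin N) → ℂ,
      DifferentiableOn ℂ g (unitBall N) → modular ψ g (weightedVolume N α) 1 ≤ 1 →
        ∫⁻ z in {z | r < ‖z‖}, ENNReal.ofReal (ψ (K * ‖g z‖)) ∂μ ≤ ENNReal.ofReal ε := by
  obtain ⟨C, hC, Hg⟩ := exists_norm_le N hα
  obtain ⟨x₀, hx₀, hnab⟩ := hψ.exists_mul_le_of_nablaZero hψ₀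
  obtain ⟨B, hB, hnab⟩ := hnab K hK
  set d : ℝ := (N : ℝ) + 1 + α with hd
  have hd0 : 0 < d := by
    have : (0 : ℝ) ≤ N := Nat.cast_nonneg N
    linarith
  -- From `20(1 - |w|²) ≤ 40(1 - |z|²)`, the growth bound `C / (1 - |z|²) ^ d` is at most `M / h ^
  -- d` with `h = 20(1 - |w|²)`. The maximum with `1` permits `orliczInv_mul_le`.
  set M : ℝ := max 1 (C * 40 ^ d) with hM
  have hM1 : 1 ≤ M := le_max_left _ _
  have hM0 : 0 < M := by linarith
  have hw := hvan (B * M) (by positivity) (ε / 2) (by positivity)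
  rw [eventually_nhdsWithin_iff, Metric.eventually_nhds_iff] at hw
  obtain ⟨h₀, hh₀, hw⟩ := hw
  have hw : ∀ h : ℝ, 0 < h → h < h₀ → ∀ ξ ∈ unitSphere N, μ (carlesonWindow ξ h) ≤
      ENNReal.ofReal (ε / 2 * (1 / ψ (B * M * orliczInv ψ (1 / h ^ d)))) := fun h h1 h2 =>
    hw (by rwa [dist_zero_right, Real.norm_of_nonneg h1.le]) h1
  have hψK : 0 ≤ ψ (K * x₀) := hψ.nonneg _ (by positivity)
  -- Three demands on `r`: `15/16` forces `|z|² ≥ 7/8`; `1 - h₀/80` forces `20(1 - |w|²) < h₀`; the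
  -- small mass of the shell controls the points where `|g| ≤ x₀`.
  obtain ⟨r, hr0, hr1, hrμ⟩ := tendsto_measure_norm_gt μ hμ
    (ε := ENNReal.ofReal (ε / 2 / (ψ (K * x₀) + 1))) (by
      rw [ENNReal.ofReal_pos]; positivity) (r₀ := max (15 / 16) (1 - h₀ / 80))
    (max_lt (by norm_num) (by linarith))
  have hra : 15 / 16 < r := (le_max_left _ _).trans_lt hr0
  have hrb : 1 - h₀ / 80 < r := (le_max_right _ _).trans_lt hr0
  refine ⟨r, hr1, fun g hg hmod => ?_⟩
  set G := orliczDensity ψ g with hG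
  have hGm : Measurable G := measurable_orliczDensity hψ hg.continuousOn
  set T : Set (EuclideanSpace ℂ (Fin N)) := {z | r < ‖z‖} with hT
  have hTm : MeasurableSet T := (isOpen_lt continuous_const continuous_norm).measurableSet
  set Φ : EuclideanSpace ℂ (Fin N) → ℝ≥0∞ := fun z =>
    ENNReal.ofReal (ψ (B * orliczInv ψ (max (C / (1 - ‖z‖ ^ 2) ^ d) 0))) with hΦ
  have hΦm : Measurable Φ :=
    (measurable_comp_orliczInv hψ (by fun_prop) hB.le).ennreal_ofReal
  set Q : Set (EuclideanSpace ℂ (Fin N) × EuclideanSpace ℂ (Fin N)) :=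
    {p | p.2 ∈ nonisotropicNhd p.1} with hQ
  have hQm : MeasurableSet Q := by
    have h1 : IsOpen {p : EuclideanSpace ℂ (Fin N) × EuclideanSpace ℂ (Fin N) |
      ‖(inner ℂ p.1 (p.2 - p.1) : ℂ)‖ < 1 / 8 * (1 - ‖p.1‖ ^ 2)} :=
      isOpen_lt (by fun_prop) (by fun_prop)
    have h2 : IsOpen {p : EuclideanSpace ℂ (Fin N) × EuclideanSpace ℂ (Fin N) |
      ‖p.2 - p.1‖ ^ 2 < (1 / 8) ^ 2 * (1 - ‖p.1‖ ^ 2)} := isOpen_lt (by fun_prop) (by fun_prop)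
    exact (h1.inter h2).measurableSet
  have hnm : ∀ z : EuclideanSpace ℂ (Fin N), MeasurableSet (nonisotropicNhd z) := fun z =>
    (measurable_sub_const z) (isOpen_ellipsoid z).measurableSet
  set F : EuclideanSpace ℂ (Fin N) → EuclideanSpace ℂ (Fin N) → ℝ≥0∞ :=
    fun z w => Φ z * Q.indicator 1 (z, w) * G w with hF
  have hFm : Measurable (Function.uncurry F) :=
    ((hΦm.comp measurable_fst).mul (measurable_one.indicator hQm)).mul (hGm.comp measurable_snd)
  have hμball : ∀ᵐ z ∂μ, z ∈ unitBall N := mem_ae_iff.2 hμ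
  have hpt : ∀ z ∈ unitBall N, ENNReal.ofReal (ψ (K * ‖g z‖)) ≤
      ENNReal.ofReal (ψ (K * x₀)) + ∫⁻ w, F z w ∂weightedVolume N α := by
    intro z hz
    rcases le_total ‖g z‖ x₀ with hx | hx
    · refine le_add_right (ENNReal.ofReal_le_ofReal (hψ.mono (by positivity) ?_))
      gcongr
    · refine le_add_left ?_
      obtain ⟨hgz, hgz'⟩ := Hg ψ hψ g hg hmod z hz
      have hδ := one_sub_norm_sq_pos hz
      have hpos : 0 < C / (1 - ‖z‖ ^ 2) ^ d := by positivity
      -- Iterated `∇₀` between `|g(z)|` and the pointwise growth bound; `ψ` of the latter is the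
      -- factor `C / (1 - |z|²) ^ d` of the sub-mean value property, and cancels below.
      have hn := hnab _ _ hx hgz
      rw [hψ.map_orliczInv hpos.le] at hn
      have hFz : ∫⁻ w, F z w ∂weightedVolume N α =
          Φ z * ∫⁻ w in nonisotropicNhd z, G w ∂weightedVolume N α := by
        rw [← lintegral_indicator (hnm z), ← lintegral_const_mul _ (hGm.indicator (hnm z))]
        refine lintegral_congr fun w => ?_
        by_cases hwz : w ∈ nonisotropicNhd z
        · have : (z, w) ∈ Q := hwz
          simp [hF, this, hwz]
        · have : (z, w) ∉ Q := hwz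
          simp [hF, this, hwz]
      have hc0 : ENNReal.ofReal (C / (1 - ‖z‖ ^ 2) ^ d) ≠ 0 := by
        rw [Ne, ENNReal.ofReal_eq_zero, not_le]; exact hpos
      rw [hFz, ← ENNReal.mul_le_mul_iff_right hc0 ENNReal.ofReal_ne_top]
      calc _ = ENNReal.ofReal (ψ (K * ‖g z‖) * (C / (1 - ‖z‖ ^ 2) ^ d)) := by
            rw [ENNReal.ofReal_mul (hψ.nonneg _ (by positivity)), mul_comm]
        _ ≤ ENNReal.ofReal (ψ ‖g z‖ *
              ψ (B * orliczInv ψ (C / (1 - ‖z‖ ^ 2) ^ d))) := ENNReal.ofReal_le_ofReal hn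
        _ = ENNReal.ofReal (ψ ‖g z‖) * Φ z := by
            rw [ENNReal.ofReal_mul (hψ.nonneg _ (norm_nonneg _)), hΦ]
            simp only [max_eq_left hpos.le]
        _ ≤ _ := by
            refine (mul_le_mul_left hgz' _).trans_eq ?_
            ring
  -- For fixed `w`, the weight is at most `Ψ` and the admissible `z` fill at most one window, of
  -- mass at most `ε / (2Ψ)`.
  have hinner : ∀ w, ∫⁻ z in T, F z w ∂μ ≤ ENNReal.ofReal (ε / 2) * G w := by
    intro w
    set Tw : Set (EuclideanSpace ℂ (Fin N)) :=
      unitBall N ∩ (T ∩ (fun z => (z, w)) ⁻¹' Q) with hTw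
    have hTwm : MeasurableSet Tw := measurableSet_unitBall.inter
      (hTm.inter (measurable_prodMk_right hQm))
    set Ψ : ℝ := ψ (B * M * orliczInv ψ (1 / (20 * (1 - ‖w‖ ^ 2)) ^ d)) with hΨ
    have hle : ∫⁻ z in T, F z w ∂μ ≤ ∫⁻ z, Tw.indicator (fun z => ENNReal.ofReal Ψ * G w) z ∂μ := by
      rw [← lintegral_indicator hTm]
      refine lintegral_mono_ae ?_
      filter_upwards [hμball] with z hz
      by_cases hzT : z ∈ T
      swap
      · simp [hzT]
      by_cases hzQ : (z, w) ∈ Q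
      swap
      · simp [hzT, hzQ, hF]
      have hzTw : z ∈ Tw := ⟨hz, hzT, hzQ⟩
      rw [Set.indicator_of_mem hzT, Set.indicator_of_mem hzTw]
      simp only [hF, Set.indicator_of_mem hzQ, Pi.one_apply, mul_one]
      gcongr
      refine ENNReal.ofReal_le_ofReal ?_
      have hδ := one_sub_norm_sq_pos hz
      have hwz' : w - z ∈ ellipsoid z := hzQ
      have hb := one_sub_norm_sq_bounds (z := z) (u := w - z) hwz'
      rw [add_sub_cancel] at hb
      have hpos : 0 < C / (1 - ‖z‖ ^ 2) ^ d := by positivity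
      have hHpos : 0 < 20 * (1 - ‖w‖ ^ 2) := by linarith
      rw [max_eq_left hpos.le, hΨ, mul_assoc]
      refine hψ.mono (by have := hψ.orliczInv_nonneg hpos.le; positivity) ?_
      gcongr
      refine le_trans (hψ.orliczInv_mono hpos.le ?_) (hψ.orliczInv_mul_le hM1 (by positivity))
      have h40 : (20 * (1 - ‖w‖ ^ 2)) ^ d ≤ 40 ^ d * (1 - ‖z‖ ^ 2) ^ d := by
        rw [← Real.mul_rpow (by norm_num) hδ.le]
        exact Real.rpow_le_rpow hHpos.le (by linarith) hd0.le
      calc C / (1 - ‖z‖ ^ 2) ^ d = C * 40 ^ d * (1 / (40 ^ d * (1 - ‖z‖ ^ 2) ^ d)) := by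
            have : (40 : ℝ) ^ d ≠ 0 := (Real.rpow_pos_of_pos (by norm_num) d).ne'
            field_simp
        _ ≤ M * (1 / (20 * (1 - ‖w‖ ^ 2)) ^ d) := by
            gcongr
            exact le_max_right _ _
    refine hle.trans ?_
    rw [lintegral_indicator hTwm, setLIntegral_const]
    rcases Set.eq_empty_or_nonempty Tw with he | ⟨z₀, hz₀, hz₀T, hz₀Q⟩
    · simp [he]
    have hb := one_sub_norm_sq_bounds (z := z₀) (u := w - z₀) hz₀Q
    rw [add_sub_cancel] at hb
    have hδ := one_sub_norm_sq_pos hz₀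
    have hsq : ∀ z ∈ T, 7 / 8 ≤ ‖z‖ ^ 2 := fun z hz => by
      have : r < ‖z‖ := hz
      nlinarith
    have hHpos : 0 < 20 * (1 - ‖w‖ ^ 2) := by linarith
    have hHlt : 20 * (1 - ‖w‖ ^ 2) < h₀ := by
      have h1 : r < ‖z₀‖ := hz₀T
      have h2 : ‖z₀‖ < 1 := mem_ball_zero_iff.1 hz₀
      nlinarith
    have hsub : Tw ⊆ carlesonWindow ((‖w‖⁻¹ : ℂ) • w) (20 * (1 - ‖w‖ ^ 2)) := fun z hz =>
      (mem_carlesonWindow hz.1 (hsq z hz.2.1) hz.2.2).2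
    have hξ := (mem_carlesonWindow hz₀ (hsq z₀ hz₀T) hz₀Q).1
    have hΨpos : 0 < Ψ := by
      refine hψ.pos ?_
      have := hψ.orliczInv_pos (t := 1 / (20 * (1 - ‖w‖ ^ 2)) ^ d) (by positivity)
      positivity
    calc _ ≤ ENNReal.ofReal Ψ * G w * ENNReal.ofReal (ε / 2 * (1 / Ψ)) := by
          gcongr
          exact (measure_mono hsub).trans (hw _ hHpos hHlt _ hξ)
      _ = ENNReal.ofReal Ψ * ENNReal.ofReal (ε / 2 * (1 / Ψ)) * G w := by ring
      _ = _ := by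
          rw [← ENNReal.ofReal_mul hΨpos.le]
          congr 2
          field_simp
  calc ∫⁻ z in T, ENNReal.ofReal (ψ (K * ‖g z‖)) ∂μ
      ≤ ∫⁻ z in T, (ENNReal.ofReal (ψ (K * x₀)) + ∫⁻ w, F z w ∂weightedVolume N α) ∂μ :=
        lintegral_mono_ae (ae_restrict_of_ae (hμball.mono hpt))
    _ = ENNReal.ofReal (ψ (K * x₀)) * μ T +
          ∫⁻ w, ∫⁻ z in T, F z w ∂μ ∂weightedVolume N α := by
        rw [lintegral_add_left measurable_const, setLIntegral_const,
          lintegral_lintegral_swap hFm.aemeasurable]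
    _ ≤ ENNReal.ofReal (ε / 2) + ENNReal.ofReal (ε / 2) := by
        gcongr
        · calc _ ≤ ENNReal.ofReal (ψ (K * x₀)) * ENNReal.ofReal (ε / 2 / (ψ (K * x₀) + 1)) := by
                gcongr
            _ ≤ _ := by
                rw [← ENNReal.ofReal_mul hψK]
                refine ENNReal.ofReal_le_ofReal ?_
                rw [mul_div_assoc', div_le_iff₀ (by positivity)]
                nlinarith
        · refine (lintegral_mono hinner).trans ?_
          rw [lintegral_const_mul _ hGm, hG, lintegral_orliczDensity]
          exact mul_le_of_le_one_right (zero_le) hmod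
    _ = ENNReal.ofReal ε := by
        rw [← ENNReal.ofReal_add (by positivity) (by positivity), add_halves]

/-! ### Normal families and sufficiency. -/

/-- A locally bounded sequence of holomorphic functions on the ball has a subsequence which
converges at every point. -/
theorem exists_subseq_tendsto {F : ℕ → EuclideanSpace ℂ (Fin N) → ℂ}
    (hF : ∀ n, DifferentiableOn ℂ (F n) (unitBall N))
    (hb : ∀ r : ℝ, r < 1 → ∃ M : ℝ, ∀ n z, ‖z‖ ≤ r → ‖F n z‖ ≤ M) :
    ∃ φ : ℕ → ℕ, StrictMono φ ∧ ∃ g : EuclideanSpace ℂ (Fin N) → ℂ, ∀ z ∈ unitBall N,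
      Tendsto (fun n => F (φ n) z) atTop (𝓝 (g z)) := by
  classical
  set q := TopologicalSpace.denseSeq (EuclideanSpace ℂ (Fin N)) with hq
  have hqM : ∀ k, ∃ M : ℝ, ∀ n, q k ∈ unitBall N → ‖F n (q k)‖ ≤ M := by
    intro k
    by_cases hk : q k ∈ unitBall N
    · obtain ⟨M, hM⟩ := hb ‖q k‖ (mem_ball_zero_iff.1 hk)
      exact ⟨M, fun n _ => hM n _ le_rfl⟩
    · exact ⟨0, fun n h => absurd h hk⟩
  choose M hM using hqM
  -- The values at a dense sequence of points form a sequence in a compact countable product of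
  -- discs, which plays the role of a diagonal extraction. Points off the ball get the value `0`.
  set x : ℕ → ℕ → ℂ := fun n k => if q k ∈ unitBall N then F n (q k) else 0 with hx
  have hcomp : IsCompact (Set.univ.pi fun k => Metric.closedBall (0 : ℂ) (max (M k) 0)) :=
    isCompact_univ_pi fun k => isCompact_closedBall _ _
  obtain ⟨a, -, φ, hφ, hlim⟩ := hcomp.tendsto_subseq (x := x) fun n => by
    rw [Set.mem_univ_pi]
    intro k
    rw [mem_closedBall_zero_iff]
    by_cases hk : q k ∈ unitBall N
    · simp only [hx, if_pos hk]
      exact (hM k n hk).trans (le_max_left _ _)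
    · simp [hx, hk]
  rw [tendsto_pi_nhds] at hlim
  have hconv : ∀ k, q k ∈ unitBall N → CauchySeq fun n => F (φ n) (q k) := by
    intro k hk
    have := (hlim k).cauchySeq
    simpa [hx, hk, Function.comp_def] using this
  have hcauchy : ∀ z ∈ unitBall N, CauchySeq fun n => F (φ n) z := by
    intro z hz
    have hz1 : ‖z‖ < 1 := mem_ball_zero_iff.1 hz
    set ρ : ℝ := (1 - ‖z‖) / 2 with hρ
    have hρ0 : 0 < ρ := by linarith
    obtain ⟨B, hB⟩ := hb (‖z‖ + ρ) (by linarith)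
    have hB0 : 0 ≤ B := (norm_nonneg _).trans (hB 0 z (by linarith))
    have hsub : Metric.ball z ρ ⊆ unitBall N := fun w hw => by
      rw [unitBall, mem_ball_zero_iff]
      have := norm_le_norm_add_norm_sub' w z
      rw [mem_ball_iff_norm] at hw
      linarith
    -- The Schwarz lemma gives a Lipschitz constant independent of `n`, carrying convergence from
    -- the dense points to `z`.
    have hlip : ∀ n, ∀ w ∈ Metric.ball z ρ, dist (F n w) (F n z) ≤ 2 * B / ρ * dist w z := by
      intro n w hw
      refine Complex.dist_le_div_mul_dist_of_mapsTo_ball ((hF n).mono hsub) (fun v hv => ?_) hw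
      rw [mem_closedBall_iff_norm]
      have h1 := norm_sub_le (F n v) (F n z)
      have h2 := hB n v (by
        have := norm_le_norm_add_norm_sub' v z
        rw [mem_ball_iff_norm] at hv
        linarith)
      have h3 := hB n z (by linarith)
      linarith
    rw [Metric.cauchySeq_iff]
    intro ε hε
    obtain ⟨w, ⟨k, rfl⟩, hw⟩ := Metric.dense_iff.1
      (TopologicalSpace.denseRange_denseSeq (EuclideanSpace ℂ (Fin N))) z
      (min ρ (ε / (3 * (2 * B / ρ + 1)))) (by positivity) |>.imp fun w h => h.symm
    have hw1 : q k ∈ Metric.ball z ρ := Metric.ball_subset_ball (min_le_left _ _) hw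
    have hw2 : dist (q k) z < ε / (3 * (2 * B / ρ + 1)) :=
      (Metric.mem_ball.1 hw).trans_le (min_le_right _ _)
    have hsmall : ∀ n, dist (F n (q k)) (F n z) < ε / 3 := by
      intro n
      refine (hlip n _ hw1).trans_lt ?_
      have h0 : 0 ≤ 2 * B / ρ := by positivity
      rw [lt_div_iff₀ (by positivity)] at hw2
      have := dist_nonneg (x := q k) (y := z)
      rcases eq_or_lt_of_le this with h | h <;> nlinarith
    obtain ⟨n₀, hn₀⟩ := Metric.cauchySeq_iff.1 (hconv k (hsub hw1)) (ε / 3) (by positivity)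
    refine ⟨n₀, fun m hm n hn => ?_⟩
    have h1 := hn₀ m hm n hn
    have h2 := hsmall (φ m)
    have h3 := hsmall (φ n)
    rw [dist_comm] at h2
    have h4 := dist_triangle4 (F (φ m) z) (F (φ m) (q k)) (F (φ n) (q k)) (F (φ n) z)
    linarith
  choose! g hg using fun z hz => cauchySeq_tendsto_of_complete (hcauchy z hz)
  exact ⟨φ, hφ, g, hg⟩

/-- Midpoint convexity; the sum of the two moduli over `2R` is the mean of the two quotients. -/
theorem modular_sub_le (hψ : IsOrliczFunction ψ) {Ω : Type*} [MeasurableSpace Ω] {ν : Measure Ω}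
    {f g : Ω → ℂ} (hf : AEStronglyMeasurable f ν) {R : ℝ} (hR : 0 < R)
    (h1 : modular ψ f ν R ≤ 1) (h2 : modular ψ g ν R ≤ 1) : modular ψ (f - g) ν (2 * R) ≤ 1 := by
  have hc : Continuous fun w : ℂ => ENNReal.ofReal (ψ (‖w‖ / R)) :=
    ENNReal.continuous_ofReal.comp (hψ.continuous_comp (by fun_prop) fun w => by positivity)
  have hm : AEMeasurable (fun z => ENNReal.ofReal (ψ (‖f z‖ / R))) ν :=
    hc.measurable.comp_aemeasurable hf.aemeasurable
  calc modular ψ (f - g) ν (2 * R)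
      ≤ ∫⁻ z, ENNReal.ofReal (1 / 2) * (ENNReal.ofReal (ψ (‖f z‖ / R)) +
          ENNReal.ofReal (ψ (‖g z‖ / R))) ∂ν := by
        refine lintegral_mono fun z => ?_
        have ha : 0 ≤ ‖f z‖ / R := by positivity
        have hb : 0 ≤ ‖g z‖ / R := by positivity
        rw [← ENNReal.ofReal_add (hψ.nonneg _ ha) (hψ.nonneg _ hb),
          ← ENNReal.ofReal_mul (by norm_num)]
        refine ENNReal.ofReal_le_ofReal ?_
        have := hψ.strictConvexOn.convexOn.2 ha hb (one_half_pos.le (α := ℝ)) one_half_pos.le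
          (add_halves 1)
        simp only [smul_eq_mul] at this
        refine le_trans (hψ.mono (by positivity) ?_) (this.trans_eq (by ring))
        rw [Pi.sub_apply, div_le_iff₀ (by positivity)]
        refine (norm_sub_le _ _).trans_eq ?_
        field_simp
    _ ≤ ENNReal.ofReal (1 / 2) * (1 + 1) := by
        rw [lintegral_const_mul' _ _ ENNReal.ofReal_ne_top, lintegral_add_left' hm]
        gcongr <;> assumption
    _ = 1 := by
        rw [one_add_one_eq_two, ← ENNReal.ofReal_ofNat, ← ENNReal.ofReal_mul (by norm_num)]
        norm_num

theorem modular_const_div {Ω : Type*} [MeasurableSpace Ω] {ν : Measure Ω} (f : Ω → ℂ) {R : ℝ}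
    (hR : 0 < R) : modular ψ (fun z => f z / R) ν 1 = modular ψ f ν R := by
  simp [modular, abs_of_pos hR]

theorem differentiableOn_div_const {f : EuclideanSpace ℂ (Fin N) → ℂ}
    {s : Set (EuclideanSpace ℂ (Fin N))} (hf : DifferentiableOn ℂ f s) (R : ℝ) :
    DifferentiableOn ℂ (fun z => f z / R) s := by
  simp only [div_eq_mul_inv]
  exact hf.mul_const _

theorem aestronglyMeasurable_of_differentiableOn {f : EuclideanSpace ℂ (Fin N) → ℂ}
    (hf : DifferentiableOn ℂ f (unitBall N)) {μ : Measure (EuclideanSpace ℂ (Fin N))}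
    (hμ : μ (unitBall N)ᶜ = 0) : AEStronglyMeasurable f μ := by
  have := hf.continuousOn.aestronglyMeasurable (μ := μ) measurableSet_unitBall
  have hr : μ.restrict (unitBall N) = μ := Measure.restrict_eq_self_of_ae_mem (mem_ae_iff.2 hμ)
  rwa [hr] at this

theorem exists_norm_le_of_modular_le [NeZero N] (hα : -1 < α) (hψ : IsOrliczFunction ψ) {R : ℝ}
    (hR : 0 < R) {r : ℝ} (hr : r < 1) : ∃ M : ℝ, 0 ≤ M ∧ ∀ f : EuclideanSpace ℂ (Fin N) → ℂ,
      DifferentiableOn ℂ f (unitBall N) → modular ψ f (weightedVolume N α) R ≤ 1 →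
        ∀ z, ‖z‖ ≤ r → ‖f z‖ ≤ M := by
  obtain ⟨C, hC, H⟩ := exists_norm_le N hα
  have hd0 : 0 ≤ (N : ℝ) + 1 + α := by
    have : (0 : ℝ) ≤ N := Nat.cast_nonneg N
    linarith
  by_cases hr0 : 0 ≤ r
  swap
  · exact ⟨0, le_rfl, fun f _ _ z hz => absurd ((norm_nonneg z).trans hz) hr0⟩
  have hrr : 0 < 1 - r ^ 2 := by nlinarith
  have hpos : 0 ≤ C / (1 - r ^ 2) ^ ((N : ℝ) + 1 + α) := by positivity
  refine ⟨R * orliczInv ψ (C / (1 - r ^ 2) ^ ((N : ℝ) + 1 + α)),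
    mul_nonneg hR.le (hψ.orliczInv_nonneg hpos), fun f hf hm z hz => ?_⟩
  have hzb : z ∈ unitBall N := mem_ball_zero_iff.2 (hz.trans_lt hr)
  have h := (H ψ hψ (fun z => f z / R) (differentiableOn_div_const hf R)
    ((modular_const_div f hR).trans_le hm) z hzb).1
  rw [norm_div, Complex.norm_real, Real.norm_of_nonneg hR.le, div_le_iff₀' hR] at h
  have hδ := one_sub_norm_sq_pos hzb
  refine h.trans ?_
  gcongr
  exact hψ.orliczInv_mono (by positivity) (by gcongr)

/-- Normalizing `f` by `R` leaves the dilation `K = R / δ`; this is why the tail estimate is needed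
for arbitrary `K`. -/
theorem exists_setLIntegral_div_le [NeZero N] (hα : -1 < α) (hψ : IsOrliczFunction ψ)
    (hψ₀ : NablaZero ψ) (μ : Measure (EuclideanSpace ℂ (Fin N))) [IsFiniteMeasure μ]
    (hμ : μ (unitBall N)ᶜ = 0) (hvan : IsVanishingBergmanCarleson N α ψ μ)
    {R δ ε : ℝ} (hR : 0 < R) (hδ : 0 < δ) (hε : 0 < ε) :
    ∃ r : ℝ, r < 1 ∧ ∀ f : EuclideanSpace ℂ (Fin N) → ℂ,
      DifferentiableOn ℂ f (unitBall N) → modular ψ f (weightedVolume N α) R ≤ 1 →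
        modular ψ f (μ.restrict {z | r < ‖z‖}) δ ≤ ENNReal.ofReal ε := by
  obtain ⟨r, hr, H⟩ := exists_setLIntegral_le hα hψ hψ₀ μ hμ hvan (K := R / δ) (by positivity) hε
  refine ⟨r, hr, fun f hf hm => ?_⟩
  refine le_trans (le_of_eq ?_) (H (fun z => f z / R) (differentiableOn_div_const hf R)
    ((modular_const_div f hR).trans_le hm))
  refine lintegral_congr fun z => ?_
  rw [norm_div, Complex.norm_real, Real.norm_of_nonneg hR.le]
  congr 2
  field_simp

theorem exists_modular_le [NeZero N] (hα : -1 < α) (hψ : IsOrliczFunction ψ)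
    (hψ₀ : NablaZero ψ) (μ : Measure (EuclideanSpace ℂ (Fin N))) [IsFiniteMeasure μ]
    (hμ : μ (unitBall N)ᶜ = 0) (hvan : IsVanishingBergmanCarleson N α ψ μ) {R : ℝ} (hR : 0 < R) :
    ∃ b : ℝ≥0∞, b < ∞ ∧ ∀ f : EuclideanSpace ℂ (Fin N) → ℂ,
      DifferentiableOn ℂ f (unitBall N) → modular ψ f (weightedVolume N α) R ≤ 1 →
        modular ψ f μ R ≤ b := by
  obtain ⟨r, hr, H⟩ := exists_setLIntegral_div_le hα hψ hψ₀ μ hμ hvan hR hR one_pos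
  obtain ⟨M, hM, HM⟩ := exists_norm_le_of_modular_le (N := N) hα hψ hR hr
  have hT : MeasurableSet {z : EuclideanSpace ℂ (Fin N) | r < ‖z‖} :=
    (isOpen_lt continuous_const continuous_norm).measurableSet
  refine ⟨ENNReal.ofReal 1 + ENNReal.ofReal (ψ (M / R)) * μ Set.univ,
    ENNReal.add_lt_top.2 ⟨ENNReal.ofReal_lt_top,
      ENNReal.mul_lt_top ENNReal.ofReal_lt_top (measure_lt_top _ _)⟩, fun f hf hm => ?_⟩
  rw [modular, ← lintegral_add_compl _ hT]
  gcongr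
  · exact H f hf hm
  · calc _ ≤ ∫⁻ _z in {z : EuclideanSpace ℂ (Fin N) | r < ‖z‖}ᶜ,
            ENNReal.ofReal (ψ (M / R)) ∂μ := by
          refine setLIntegral_mono' hT.compl fun z hz => ENNReal.ofReal_le_ofReal ?_
          refine hψ.mono (by positivity) ?_
          gcongr
          exact HM f hf hm z (not_lt.1 hz)
      _ ≤ _ := by
          rw [setLIntegral_const]
          gcongr
          exact Set.subset_univ _

/-- Sufficiency of the vanishing Carleson condition. -/
theorem embedsCompactly_of_isVanishing [NeZero N] (hα : -1 < α) (hψ : IsOrliczFunction ψ)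
    (hψ₀ : NablaZero ψ) (μ : Measure (EuclideanSpace ℂ (Fin N))) [IsFiniteMeasure μ]
    (hμ : μ (unitBall N)ᶜ = 0) (hvan : IsVanishingBergmanCarleson N α ψ μ) :
    EmbedsCompactly N α ψ μ := by
  refine ⟨fun f hf => ⟨aestronglyMeasurable_of_differentiableOn hf.1 hμ, ?_⟩, fun f hf hR => ?_⟩
  · obtain ⟨R, hR, hm⟩ := exists_modular_le_one hψ hf.2
    obtain ⟨b, hb, H⟩ := exists_modular_le hα hψ hψ₀ μ hμ hvan hR
    exact ⟨R, hR, (H f hf.1 hm).trans_lt hb⟩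
  obtain ⟨R₀, hR₀⟩ := hR
  -- Strictly above the norm bound, so that the modulars at scale `R` are at most `1`.
  set R : ℝ := R₀ + 1 with hRdef
  have hR : 0 < R := by positivity
  have hm : ∀ n, modular ψ (f n) (weightedVolume N α) R ≤ 1 := fun n =>
    modular_le_one_of_luxemburgNorm_lt hψ ((hR₀ n).trans_lt (by
      rw [hRdef, ← ENNReal.ofReal_coe_nnreal, ENNReal.ofReal_lt_ofReal_iff hR]
      linarith))
  obtain ⟨φ, hφ, g, hg⟩ := exists_subseq_tendsto (fun n => (hf n).1) fun r hr => by
    obtain ⟨M, -, hM⟩ := exists_norm_le_of_modular_le (N := N) hα hψ hR hr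
    exact ⟨M, fun n => hM (f n) (hf n).1 (hm n)⟩
  have hμball : ∀ᵐ z ∂μ, z ∈ unitBall N := mem_ae_iff.2 hμ
  have hlim : ∀ᵐ z ∂μ, Tendsto (fun n => f (φ n) z) atTop (𝓝 (g z)) := hμball.mono hg
  have hfm : ∀ n, AEStronglyMeasurable (f n) μ := fun n =>
    aestronglyMeasurable_of_differentiableOn (hf n).1 hμ
  have hgm : AEStronglyMeasurable g μ :=
    aestronglyMeasurable_of_tendsto_ae atTop (fun n => hfm (φ n)) hlim
  refine ⟨g, ⟨hgm, R, hR, ?_⟩, φ, hφ, ?_⟩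
  · obtain ⟨b, hb, H⟩ := exists_modular_le hα hψ hψ₀ μ hμ hvan hR
    refine ((modular_le_liminf hψ hR (fun n => hfm (φ n)) hlim).trans ?_).trans_lt hb
    exact liminf_le_of_le (by isBoundedDefault) fun c hc => by
      obtain ⟨n, hn⟩ := hc.exists
      exact hn.trans (H _ (hf _).1 (hm _))
  rw [tendsto_luxemburgNorm_zero_iff hψ]
  intro δ hδ
  obtain ⟨r, hr, H⟩ := exists_setLIntegral_div_le hα hψ hψ₀ μ hμ hvan (R := 2 * R) (ε := 1 / 2)
    (by positivity) hδ (by norm_num)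
  obtain ⟨M, hM0, hM⟩ := exists_norm_le_of_modular_le (N := N) hα hψ hR hr
  set T : Set (EuclideanSpace ℂ (Fin N)) := {z | r < ‖z‖} with hT
  have hTm : MeasurableSet T := (isOpen_lt continuous_const continuous_norm).measurableSet
  -- By Fatou, `f (φ n) - g` is handled as the limit in `m` of the holomorphic differences `f (φ n)
  -- - f (φ m)`, whose modular at `2R` is at most `1`; holomorphy of `g` need not be established.
  have houter : ∀ n, modular ψ (f (φ n) - g) (μ.restrict T) δ ≤ ENNReal.ofReal (1 / 2) := by
    intro n
    refine (modular_le_liminf (F := fun m => f (φ n) - f (φ m)) hψ hδ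
      (fun m => ((hfm _).sub (hfm _)).restrict)
      (ae_restrict_of_ae (hlim.mono fun z hz => hz.const_sub _))).trans ?_
    exact liminf_le_of_le (by isBoundedDefault) fun c hc => by
      obtain ⟨m, hm'⟩ := hc.exists
      exact hm'.trans (H _ ((hf _).1.sub (hf _).1) (modular_sub_le hψ
        (aestronglyMeasurable_of_differentiableOn (hf _).1 weightedVolume_compl_unitBall)
        hR (hm _) (hm _)))
  have hc : Continuous fun w : ℂ => ENNReal.ofReal (ψ (‖w‖ / δ)) :=
    ENNReal.continuous_ofReal.comp (hψ.continuous_comp (by fun_prop) fun w => by positivity)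
  have hinner : Tendsto (fun n => ∫⁻ z in Tᶜ, ENNReal.ofReal (ψ (‖(f (φ n) - g) z‖ / δ)) ∂μ) atTop
      (𝓝 (∫⁻ _z in Tᶜ, 0 ∂μ)) := by
    refine tendsto_lintegral_of_dominated_convergence'
      (fun _ => ENNReal.ofReal (ψ ((M + M) / δ))) (fun n => ?_) (fun n => ?_) ?_ ?_
    · exact hc.measurable.comp_aemeasurable ((hfm _).sub hgm).restrict.aemeasurable
    · filter_upwards [ae_restrict_mem hTm.compl, ae_restrict_of_ae hμball] with z hz hzb
      have hzr : ‖z‖ ≤ r := not_lt.1 hz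
      refine ENNReal.ofReal_le_ofReal (hψ.mono (by positivity) ?_)
      gcongr
      refine (norm_sub_le _ _).trans ?_
      gcongr
      · exact hM _ (hf _).1 (hm _) z hzr
      · exact le_of_tendsto' (hg z hzb).norm fun n => hM _ (hf _).1 (hm _) z hzr
    · rw [setLIntegral_const]
      exact (ENNReal.mul_lt_top ENNReal.ofReal_lt_top (measure_lt_top _ _)).ne
    · filter_upwards [ae_restrict_of_ae hlim] with z hz
      have h1 : Tendsto (fun n => (f (φ n) - g) z) atTop (𝓝 0) := by
        simpa using hz.sub_const (g z)
      have h2 := (hc.tendsto 0).comp h1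
      simpa [Function.comp_def, hψ.map_zero] using h2
  rw [lintegral_zero] at hinner
  filter_upwards [hinner.eventually_lt_const
    (show (0 : ℝ≥0∞) < ENNReal.ofReal (1 / 2) by simp)] with n hn
  rw [modular, ← lintegral_add_compl _ hTm]
  calc _ ≤ ENNReal.ofReal (1 / 2) + ENNReal.ofReal (1 / 2) := add_le_add (houter n) hn.le
    _ = 1 := by
        rw [← ENNReal.ofReal_add (by norm_num) (by norm_num)]
        norm_num

/-! ### Test functions and necessity. -/

/-- The test function `T (h / (1 + h - ⟨z, ξ⟩)) ^ k`. -/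
def testFunction (T h : ℝ) (ξ : EuclideanSpace ℂ (Fin N)) (k : ℕ) :
    EuclideanSpace ℂ (Fin N) → ℂ :=
  fun z => T * (h / (1 + h - inner ℂ ξ z)) ^ k

theorem norm_testFunction {T h : ℝ} (hT : 0 ≤ T) (hh : 0 ≤ h) (ξ z : EuclideanSpace ℂ (Fin N))
    (k : ℕ) : ‖testFunction T h ξ k z‖ = T * (h / ‖1 + (h : ℂ) - inner ℂ ξ z‖) ^ k := by
  rw [testFunction, norm_mul, norm_pow, norm_div, Complex.norm_real, Complex.norm_real,
    Real.norm_of_nonneg hT, Real.norm_of_nonneg hh]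

theorem le_norm_kernel_denom {h : ℝ} {ξ z : EuclideanSpace ℂ (Fin N)} (hξ : ξ ∈ unitSphere N) :
    1 - ‖z‖ + h ≤ ‖1 + (h : ℂ) - inner ℂ ξ z‖ := by
  have hre : (inner ℂ ξ z : ℂ).re ≤ ‖z‖ :=
    (Complex.re_le_norm _).trans (norm_inner_le_norm hξ)
  refine le_trans ?_ (Complex.re_le_norm _)
  simp only [Complex.sub_re, Complex.add_re, Complex.one_re, Complex.ofReal_re]
  linarith

theorem differentiableOn_testFunction {T h : ℝ} (hh : 0 < h) {ξ : EuclideanSpace ℂ (Fin N)}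
    (hξ : ξ ∈ unitSphere N) (k : ℕ) :
    DifferentiableOn ℂ (testFunction T h ξ k) (unitBall N) := by
  have hl : Differentiable ℂ fun z : EuclideanSpace ℂ (Fin N) => (inner ℂ ξ z : ℂ) :=
    (innerSL ℂ ξ).differentiable
  unfold testFunction
  simp only [div_eq_mul_inv]
  refine DifferentiableOn.const_mul (DifferentiableOn.pow (DifferentiableOn.const_mul
    (DifferentiableOn.inv ?_ fun z hz => ?_) _) k) _
  · exact ((differentiable_const _).sub hl).differentiableOn
  · have h1 : ‖z‖ < 1 := mem_ball_zero_iff.1 hz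
    have := le_norm_kernel_denom (h := h) (z := z) hξ
    exact norm_pos_iff.1 (lt_of_lt_of_le (by linarith) this)

/-- Split off the radial part: `1 - |z|`, the shift `h` and the angular part contribute at most `h`
each. Hence the test function stays above `T / 3 ^ k` on the window. -/
theorem norm_kernel_denom_le {h : ℝ} (hh : 0 < h) (hh1 : h < 1)
    {ξ z : EuclideanSpace ℂ (Fin N)} (hz : z ∈ carlesonWindow ξ h) :
    ‖1 + (h : ℂ) - inner ℂ ξ z‖ ≤ 3 * h := by
  obtain ⟨hzb, h1, h2⟩ := hz
  have hz1 : ‖z‖ < 1 := mem_ball_zero_iff.1 hzb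
  have hz0 : 0 < ‖z‖ := by linarith
  have hz0' : (‖z‖ : ℂ) ≠ 0 := by exact_mod_cast hz0.ne'
  rw [nonisotropicDist, Real.sq_sqrt (norm_nonneg _), inner_smul_right] at h2
  have e : 1 + (h : ℂ) - inner ℂ ξ z = ((1 - ‖z‖ + h : ℝ) : ℂ) +
      (‖z‖ : ℂ) * (1 - (‖z‖ : ℂ)⁻¹ * inner ℂ ξ z) := by
    push_cast
    field_simp
    ring
  rw [e]
  refine (norm_add_le _ _).trans ?_
  rw [norm_mul, Complex.norm_real, Complex.norm_real, norm_norm, Real.norm_of_nonneg (by linarith)]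
  nlinarith [norm_nonneg (1 - (‖z‖ : ℂ)⁻¹ * inner ℂ ξ z)]

/-- Convexity bounds the modular at scale `1` by `1/(n + 1)` times the modular at scale `1/(n + 1)`,
so it vanishes. -/
theorem ae_eq_zero_of_modular_le {Ω : Type*} [MeasurableSpace Ω] {ν : Measure Ω}
    (hψ : IsOrliczFunction ψ) {f : Ω → ℂ} (hf : AEStronglyMeasurable f ν)
    (h : ∀ δ : ℝ, 0 < δ → modular ψ f ν δ ≤ 1) : f =ᵐ[ν] 0 := by
  have hc : Continuous fun w : ℂ => ENNReal.ofReal (ψ (‖w‖ / 1)) :=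
    ENNReal.continuous_ofReal.comp (hψ.continuous_comp (by fun_prop) fun w => by positivity)
  have hle : ∀ n : ℕ, modular ψ f ν 1 ≤ ENNReal.ofReal (((n : ℝ) + 1)⁻¹) := fun n => by
    have hn : (0 : ℝ) ≤ n := Nat.cast_nonneg n
    have := modular_mul_le (f := f) (μ := ν) hψ (C := ((n : ℝ) + 1)⁻¹) (t := (n : ℝ) + 1)
      (by positivity) (by linarith)
    rw [mul_inv_cancel₀ (by positivity)] at this
    exact this.trans (mul_le_of_le_one_right (zero_le) (h _ (by positivity)))
  have h0 : modular ψ f ν 1 = 0 := by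
    have hlim : Tendsto (fun n : ℕ => ENNReal.ofReal (((n : ℝ) + 1)⁻¹)) atTop (𝓝 0) := by
      have := ENNReal.tendsto_ofReal (tendsto_one_div_add_atTop_nhds_zero_nat (𝕜 := ℝ))
      simpa using this
    exact le_antisymm (ge_of_tendsto' hlim hle) (zero_le)
  have h1 := (lintegral_eq_zero_iff' (hc.measurable.comp_aemeasurable hf.aemeasurable)).1 h0
  filter_upwards [h1] with z hz
  by_contra hne
  have hpos := hψ.pos (x := ‖f z‖ / 1) (by simpa using hne)
  simp only [Function.comp_apply, Pi.zero_apply, ENNReal.ofReal_eq_zero] at hz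
  linarith

/-- Necessity of the vanishing Carleson condition. -/
theorem isVanishing_of_embedsCompactly [NeZero N] (hα : -1 < α) (hψ : IsOrliczFunction ψ)
    (μ : Measure (EuclideanSpace ℂ (Fin N))) (hμ : μ (unitBall N)ᶜ = 0)
    (hE : EmbedsCompactly N α ψ μ) : IsVanishingBergmanCarleson N α ψ μ := by
  intro A hA ε hε
  by_contra hcon
  set d : ℝ := (N : ℝ) + 1 + α with hd
  have hd0 : 0 < d := by
    have : (0 : ℝ) ≤ N := Nat.cast_nonneg N
    linarith
  obtain ⟨H, hHlim, hH⟩ := exists_seq_forall_of_frequently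
    (not_eventually.1 hcon |>.and_eventually (Ioo_mem_nhdsGT (one_pos (α := ℝ))))
  have hH01 : ∀ n, 0 < H n ∧ H n < 1 := fun n => (hH n).2
  have hHex : ∀ n, ∃ ξ ∈ unitSphere N,
      ENNReal.ofReal (ε * (1 / ψ (A * orliczInv ψ (1 / H n ^ d)))) < μ (carlesonWindow ξ (H n)) := by
    intro n
    have := (hH n).1
    push Not at this
    exact this
  choose ξ hξ hξμ using hHex
  obtain ⟨k, hk⟩ := exists_nat_ge (d + 1)
  obtain ⟨C, hC, hker⟩ := exists_lintegral_kernel_le N hα hk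
  set T : ℕ → ℝ := fun n => orliczInv ψ (1 / H n ^ d) with hT
  have hpow : ∀ n, 0 < H n ^ d := fun n => Real.rpow_pos_of_pos (hH01 n).1 d
  have hT0 : ∀ n, 0 < T n := fun n => hψ.orliczInv_pos (by have := hpow n; positivity)
  set f : ℕ → EuclideanSpace ℂ (Fin N) → ℂ := fun n => testFunction (T n) (H n) (ξ n) k with hf
  have hfd : ∀ n, DifferentiableOn ℂ (f n) (unitBall N) := fun n =>
    differentiableOn_testFunction (hH01 n).1 (hξ n) k
  -- `C` offsets the kernel integral, and `R ≥ 1` keeps the factor `q / R` at most `1`, as convexity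
  -- requires.
  set R : ℝ := max 1 C with hR
  have hR1 : 1 ≤ R := le_max_left _ _
  have hR0 : 0 < R := by linarith
  have hnorm : ∀ n z, ‖f n z‖ = T n * (H n / ‖1 + (H n : ℂ) - inner ℂ (ξ n) z‖) ^ k := fun n z =>
    norm_testFunction (hT0 n).le (hH01 n).1.le _ _ _
  have hmod : ∀ n, modular ψ (f n) (weightedVolume N α) R ≤ 1 := by
    intro n
    have hpt : ∀ᵐ z ∂weightedVolume N α, ENNReal.ofReal (ψ (‖f n z‖ / R)) ≤
        ENNReal.ofReal (1 / (R * H n ^ d)) *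
          ENNReal.ofReal ((H n / ‖1 + (H n : ℂ) - inner ℂ (ξ n) z‖) ^ k) := by
      filter_upwards [ae_mem_unitBall] with z hz
      have hz1 : ‖z‖ < 1 := mem_ball_zero_iff.1 hz
      have hden := le_norm_kernel_denom (h := H n) (z := z) (hξ n)
      have hHn := (hH01 n).1
      have hq0 : 0 ≤ H n / ‖1 + (H n : ℂ) - inner ℂ (ξ n) z‖ := by positivity
      have hq1 : (H n / ‖1 + (H n : ℂ) - inner ℂ (ξ n) z‖) ^ k ≤ 1 :=
        pow_le_one₀ hq0 (div_le_one_of_le₀ (by linarith) (norm_nonneg _))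
      have hpn := hpow n
      rw [← ENNReal.ofReal_mul (by positivity), hnorm]
      refine ENNReal.ofReal_le_ofReal ?_
      set q := (H n / ‖1 + (H n : ℂ) - inner ℂ (ξ n) z‖) ^ k
      have hq : 0 ≤ q := pow_nonneg hq0 k
      have := hψ.map_mul_le (t := q / R) (x := T n) (by positivity)
        (div_le_one_of_le₀ (hq1.trans hR1) hR0.le) (hT0 n).le
      rw [hψ.map_orliczInv (by positivity)] at this
      calc ψ (T n * q / R) = ψ (q / R * T n) := by congr 1; ring
        _ ≤ q / R * (1 / H n ^ d) := this
        _ = _ := by field_simp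
    have hpn := hpow n
    calc _ ≤ _ := lintegral_mono_ae hpt
      _ ≤ ENNReal.ofReal (1 / (R * H n ^ d)) * ENNReal.ofReal (C * H n ^ d) := by
          rw [lintegral_const_mul' _ _ ENNReal.ofReal_ne_top]
          gcongr
          exact hker _ (hξ n) _ (hH01 n).1
      _ ≤ 1 := by
          rw [← ENNReal.ofReal_mul (by positivity), ENNReal.ofReal_le_one, one_div_mul_eq_div,
            div_le_one (by positivity)]
          gcongr
          exact le_max_right _ _
  have hmem : ∀ n, f n ∈ bergmanOrlicz N α ψ := fun n =>
    ⟨hfd n, aestronglyMeasurable_of_differentiableOn (hfd n) weightedVolume_compl_unitBall,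
      R, hR0, (hmod n).trans_lt ENNReal.one_lt_top⟩
  obtain ⟨g, ⟨hgm, -⟩, φ, hφ, hlim⟩ := hE.2 f hmem
    ⟨R.toNNReal, fun n => luxemburgNorm_le hR0 (hmod n)⟩
  rw [tendsto_luxemburgNorm_zero_iff hψ] at hlim
  have hH0 : Tendsto H atTop (𝓝 0) := hHlim.mono_right nhdsWithin_le_nhds
  have hfm : ∀ n, AEStronglyMeasurable (f n) μ := fun n =>
    aestronglyMeasurable_of_differentiableOn (hfd n) hμ
  have hpt0 : ∀ z ∈ unitBall N, Tendsto (fun n => f n z) atTop (𝓝 0) := by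
    intro z hz
    have hz1 : 0 < 1 - ‖z‖ := sub_pos.2 (mem_ball_zero_iff.1 hz)
    -- The amplitude is at most `ψ⁻¹(1) / H ^ d` by concavity of the inverse, while `H ^ k ≤ H ^ (d
    -- + 1)`: one power of `H` is left over.
    refine squeeze_zero_norm (a := fun n => orliczInv ψ 1 / (1 - ‖z‖) ^ k * H n) (fun n => ?_)
      (by simpa using hH0.const_mul (orliczInv ψ 1 / (1 - ‖z‖) ^ k))
    have hHn := (hH01 n).1
    have hpn := hpow n
    have hi1 := hψ.orliczInv_nonneg zero_le_one
    have hTle : T n ≤ 1 / H n ^ d * orliczInv ψ 1 := by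
      have := hψ.orliczInv_mul_le (M := 1 / H n ^ d) (t := 1)
        ((one_le_div hpn).2 (Real.rpow_le_one hHn.le (hH01 n).2.le hd0.le)) zero_le_one
      rwa [mul_one] at this
    have hden := le_norm_kernel_denom (h := H n) (z := z) (hξ n)
    have hHk : H n ^ k ≤ H n ^ d * H n := by
      rw [← Real.rpow_natCast, ← Real.rpow_add_one hHn.ne']
      exact Real.rpow_le_rpow_of_exponent_ge hHn (hH01 n).2.le hk
    rw [hnorm]
    calc _ ≤ 1 / H n ^ d * orliczInv ψ 1 * (H n / (1 - ‖z‖)) ^ k := by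
          gcongr
          linarith
      _ = orliczInv ψ 1 / (1 - ‖z‖) ^ k * (H n ^ k / H n ^ d) := by
          rw [div_pow]; field_simp
      _ ≤ _ := by
          gcongr
          rw [div_le_iff₀ hpn, mul_comm]
          exact hHk
  -- The norm limit must agree with the pointwise limit: Fatou applied to `f (φ n) - g` bounds the
  -- modular of `-g` by `1` at every scale.
  have hg0 : -g =ᵐ[μ] 0 := by
    refine ae_eq_zero_of_modular_le hψ hgm.neg fun δ hδ => ?_
    have hF := modular_le_liminf (F := fun n => f (φ n) - g) (f := -g) hψ hδ
      (fun n => (hfm _).sub hgm) (by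
        filter_upwards [show ∀ᵐ z ∂μ, z ∈ unitBall N from mem_ae_iff.2 hμ] with z hz
        simpa using ((hpt0 z hz).comp hφ.tendsto_atTop).sub_const (g z))
    refine hF.trans (liminf_le_of_le (by isBoundedDefault) fun c hc => ?_)
    obtain ⟨n, h1, h2⟩ := (hc.and (hlim δ hδ)).exists
    exact h1.trans h2
  -- At the scale `η / (A 3 ^ k)`, the integrand on the window is at least `ψ(A T / η) ≥ ψ(A T) /
  -- η`; the second inequality needs `η ≤ 1`, and the final contradiction needs `η ≤ ε`.
  set η : ℝ := min ε 1 with hη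
  have hη0 : 0 < η := lt_min hε one_pos
  obtain ⟨n, hn⟩ := (hlim (η / (A * 3 ^ k)) (by positivity)).exists
  have hn' : modular ψ (f (φ n)) μ (η / (A * 3 ^ k)) ≤ 1 := by
    refine le_trans (le_of_eq (lintegral_congr_ae ?_)) hn
    filter_upwards [hg0] with z hz
    have : g z = 0 := by simpa using hz
    simp [this]
  set m := φ n
  set P : ℝ := ψ (A * T m) with hP
  have hPpos : 0 < P := hψ.pos (mul_pos hA (hT0 m))
  have hsub : carlesonWindow (ξ m) (H m) ⊆
      {z | ENNReal.ofReal (P / η) ≤ ENNReal.ofReal (ψ (‖f m z‖ / (η / (A * 3 ^ k))))} := by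
    intro z hz
    refine ENNReal.ofReal_le_ofReal ?_
    have hHm := (hH01 m).1
    have hden := norm_kernel_denom_le hHm (hH01 m).2 hz
    have hz1 : ‖z‖ < 1 := mem_ball_zero_iff.1 hz.1
    have hden' := le_norm_kernel_denom (h := H m) (z := z) (hξ m)
    have hTm := hT0 m
    have h1 : (1 / 3 : ℝ) ≤ H m / ‖1 + (H m : ℂ) - inner ℂ (ξ m) z‖ := by
      rw [le_div_iff₀ (by linarith)]
      linarith
    have h2 := hψ.mul_map_le (t := η⁻¹) (x := A * T m)
      ((one_le_inv₀ hη0).2 (min_le_right _ _)) (by positivity)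
    calc P / η = η⁻¹ * ψ (A * T m) := by rw [hP]; field_simp
      _ ≤ ψ (η⁻¹ * (A * T m)) := h2
      _ ≤ _ := by
          refine hψ.mono (by positivity) ?_
          rw [hnorm]
          calc η⁻¹ * (A * T m) = T m * (1 / 3) ^ k / (η / (A * 3 ^ k)) := by
                rw [div_pow, one_pow]; field_simp
            _ ≤ _ := by gcongr
  have hc : Continuous fun w : ℂ => ENNReal.ofReal (ψ (‖w‖ / (η / (A * 3 ^ k)))) :=
    ENNReal.continuous_ofReal.comp (hψ.continuous_comp (by fun_prop) fun w => by positivity)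
  have hcheb := mul_meas_ge_le_lintegral₀
    (hc.measurable.comp_aemeasurable (hfm m).aemeasurable) (ENNReal.ofReal (P / η))
  have hfin : ENNReal.ofReal (P / η) * μ (carlesonWindow (ξ m) (H m)) ≤ 1 :=
    (mul_le_mul_right (measure_mono hsub) _).trans (hcheb.trans hn')
  have hlt := hξμ m
  have hPη : 0 < P / η := by positivity
  have hcontra : (1 : ℝ≥0∞) < ENNReal.ofReal (P / η) * μ (carlesonWindow (ξ m) (H m)) := by
    calc (1 : ℝ≥0∞) ≤ ENNReal.ofReal (P / η) * ENNReal.ofReal (ε * (1 / P)) := by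
          rw [← ENNReal.ofReal_mul hPη.le, ENNReal.one_le_ofReal]
          have : η ≤ ε := min_le_left _ _
          have e : P / η * (ε * (1 / P)) = ε / η := by field_simp
          rw [e, one_le_div hη0]
          exact this
      _ < _ := by
          refine (ENNReal.mul_lt_mul_iff_right ?_ ENNReal.ofReal_ne_top).2 hlt
          simpa using hPη
  exact absurd hfin (not_le.2 hcontra)

end BergmanOrlicz

end

theorem corollary2p11 (N : ℕ) (hN : 1 ≤ N) (α : ℝ) (hα : -1 < α)
    (ψ : ℝ → ℝ) (hψ : BergmanOrlicz.IsOrliczFunction ψ) (hψ₀ : BergmanOrlicz.NablaZero ψ)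
    (μ : MeasureTheory.Measure (EuclideanSpace ℂ (Fin N))) [MeasureTheory.IsFiniteMeasure μ]
    (hμ : μ (BergmanOrlicz.unitBall N)ᶜ = 0) :
    BergmanOrlicz.EmbedsCompactly N α ψ μ ↔
      BergmanOrlicz.IsVanishingBergmanCarleson N α ψ μ := by
  have : NeZero N := ⟨by omega⟩
  exact ⟨BergmanOrlicz.isVanishing_of_embedsCompactly hα hψ μ hμ,
    BergmanOrlicz.embedsCompactly_of_isVanishing hα hψ hψ₀ μ hμ⟩
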